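/- Let $S$ be a discrete valuation ring with maximal ideal $M_S$, residue field $\bar S=S/M_S$ and field of fractions $L$, and let $G$ be a finite group of automorphisms of $S$; let $R=S^G$ be the ring of invariants and $\bar R=R/(M_S\cap R)$. Assume that $\bar S/\bar R$ is separable. Let $f\in Z^2(G,S^*)$ be a $2$-cocycle and let $T=S^f*G=\bigoplus_{g\in G}SU_g$ be the crossed product, with multiplication $sU_g\cdot tU_h=s\,g(t)\,f(g,h)\,U_{gh}$, an $R$-order in $L^f*G$. Let $G_I=\{\sigma\in G:\sigma(s)-s\in M_S\text{ for all }s\in S\}$ be the inertia group and $P=\{\sigma\in G:\sigma(s)-s\in M_S^2\text{ for all }s\in S\}$ the second ramification group. If $T$ is a hereditary ring, or if $T$ is a maximal $R$-order in $L^f*G$, then $G_I$ is abelian. More precisely, $P$ is the Sylow $p$-subgroup of $G_I$, where $p=\operatorname{char}\bar S$ (with $P$ trivial if $p=0$), and $G_I$ is the internal direct product $P\times C_{e_0}$ of $P$ and a cyclic group $C_{e_0}$ whose order $e_0$ is prime to $p$ (no condition on $e_0$ if $p=0$). -/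

import Mathlib

/-- A 2-cocycle `f ∈ Z²(G, Aˣ)` (not assumed normalized) for a group `G` acting on a commutative
ring `A` by ring automorphisms. -/
structure TwoCocycle (G A : Type*) [Group G] [CommRing A] [MulSemiringAction G A] where
  /-- the underlying map `G × G → Aˣ` -/
  toFun : G → G → Aˣ
  cocycle : ∀ g h k : G,
    (toFun g h : A) * (toFun (g * h) k : A) = g • (toFun h k : A) * (toFun g (h * k) : A)

/-- The image of a 2-cocycle under the map `Z²(G, Aˣ) → Z²(G, Bˣ)` induced by a `G`-equivariant
structure map `A → B`. -/
def TwoCocycle.baseChange {G A : Type*} [Group G] [CommRing A] [MulSemiringAction G A]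
    (f : TwoCocycle G A) (B : Type*) [CommRing B] [MulSemiringAction G B] [Algebra A B]
    [SMulDistribClass G A B] : TwoCocycle G B where
  toFun g h := Units.map (algebraMap A B).toMonoidHom (f.toFun g h)
  cocycle g h k := by
    have e : g • algebraMap A B (f.toFun h k : A) = algebraMap A B (g • (f.toFun h k : A)) := by
      rw [Algebra.algebraMap_eq_smul_one, smul_distrib_smul, smul_one,
        ← Algebra.algebraMap_eq_smul_one]
    simp only [Units.coe_map, RingHom.toMonoidHom_eq_coe, MonoidHom.coe_coe]
    rw [e, ← map_mul, ← map_mul, f.cocycle]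

/-- The crossed product `A^f * G = ⨁_{g ∈ G} A U_g`: the free left `A`-module on symbols `U_g`,
with multiplication `(s U_g) (t U_h) = s g(t) f(g,h) U_{gh}`.
The element `s U_g` is `CrossedProduct.mk f g s`. -/
def CrossedProduct {G A : Type*} [Group G] [CommRing A] [MulSemiringAction G A]
    (_f : TwoCocycle G A) : Type _ := G →₀ A

namespace CrossedProduct

section Ring

variable {G A : Type*} [Group G] [CommRing A] [MulSemiringAction G A] (f : TwoCocycle G A)

noncomputable instance : AddCommGroup (CrossedProduct f) :=
  inferInstanceAs (AddCommGroup (G →₀ A))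

/-- The left `A`-module structure, and its restriction to any ring mapping to `A`. -/
noncomputable instance {R : Type*} [CommRing R] [Algebra R A] : Module R (CrossedProduct f) :=
  inferInstanceAs (Module R (G →₀ A))

/-- The homogeneous element `s U_g`, additive in `s`. -/
noncomputable def mk (g : G) : A →+ CrossedProduct f := Finsupp.singleAddHom g

variable {f}

/-- The coefficients of an element of the crossed product: `∑ s_g U_g ↦ (s_g)_g`. -/
noncomputable def coeff : CrossedProduct f ≃+ (G →₀ A) := AddEquiv.refl (G →₀ A)

theorem coeff_mk (g : G) (s : A) : coeff (mk f g s) = Finsupp.single g s := rfl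

theorem induction_on {p : CrossedProduct f → Prop} (x : CrossedProduct f) (h0 : p 0)
    (ha : ∀ x y, p x → p y → p (x + y)) (hs : ∀ g s, p (mk f g s)) : p x :=
  Finsupp.induction_linear (motive := p) x h0 ha hs

variable (f)

noncomputable instance : Mul (CrossedProduct f) where
  mul x y := (coeff x).sum fun g s => (coeff y).sum fun h t =>
    mk f (g * h) (s * g • t * (f.toFun g h : A))

theorem mul_def' (x y : CrossedProduct f) :
    x * y = (coeff x).sum fun g s => (coeff y).sum fun h t =>
      mk f (g * h) (s * g • t * (f.toFun g h : A)) := rfl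

theorem mk_mul_mk (g h : G) (s t : A) :
    mk f g s * mk f h t = mk f (g * h) (s * g • t * (f.toFun g h : A)) := by
  rw [mul_def', coeff_mk, coeff_mk, Finsupp.sum_single_index, Finsupp.sum_single_index]
  · simp
  · rw [Finsupp.sum_single_index] <;> simp

theorem add_mul' (x y z : CrossedProduct f) : (x + y) * z = x * z + y * z := by
  rw [mul_def', mul_def', mul_def', map_add]
  refine Finsupp.sum_add_index' (fun g => ?_) (fun g s t => ?_)
  · simp only [zero_mul, map_zero]
    exact Finset.sum_const_zero
  · simp only [add_mul, map_add]
    exact Finsupp.sum_add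

theorem mul_add' (x y z : CrossedProduct f) : x * (y + z) = x * y + x * z := by
  rw [mul_def', mul_def', mul_def', map_add, ← Finsupp.sum_add]
  refine Finsupp.sum_congr fun g _ => ?_
  refine Finsupp.sum_add_index' (fun h => ?_) (fun h s t => ?_)
  · simp
  · simp [mul_add, add_mul]

/-- The identity element is `f(1,1)⁻¹ U_1`. -/
noncomputable instance : One (CrossedProduct f) where
  one := mk f 1 (((f.toFun 1 1)⁻¹ : Aˣ) : A)

theorem one_def' : (1 : CrossedProduct f) = mk f 1 (((f.toFun 1 1)⁻¹ : Aˣ) : A) := rfl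

theorem zero_mul' (x : CrossedProduct f) : 0 * x = 0 := by
  have h := add_mul' f 0 0 x
  rwa [add_zero, left_eq_add] at h

theorem mul_zero' (x : CrossedProduct f) : x * 0 = 0 := by
  have h := mul_add' f x 0 0
  rwa [add_zero, left_eq_add] at h

theorem cocycle_one_left (k : G) : (f.toFun 1 k : A) = f.toFun 1 1 := by
  have h := f.cocycle 1 1 k
  rw [one_mul, one_mul, one_smul] at h
  exact ((f.toFun 1 k).isUnit.mul_right_cancel h).symm

theorem cocycle_one_right (g : G) : (f.toFun g 1 : A) = g • (f.toFun 1 1 : A) := by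
  have h := f.cocycle g 1 1
  rw [mul_one, mul_one] at h
  exact (f.toFun g 1).isUnit.mul_right_cancel h

theorem mul_assoc' (x y z : CrossedProduct f) : x * y * z = x * (y * z) := by
  induction x using induction_on with
  | h0 => simp only [zero_mul']
  | ha x x' hx hx' => simp only [add_mul', hx, hx']
  | hs g s =>
    induction y using induction_on with
    | h0 => simp only [zero_mul', mul_zero']
    | ha y y' hy hy' => simp only [add_mul', mul_add', hy, hy']
    | hs h t =>
      induction z using induction_on with
      | h0 => simp only [mul_zero']
      | ha z z' hz hz' => simp only [mul_add', hz, hz']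
      | hs k u =>
        simp only [mk_mul_mk, mul_assoc g h k]
        congr 1
        have := f.cocycle g h k
        simp only [smul_mul', ← mul_smul]
        linear_combination (s * g • t * (g * h) • u) * this

theorem one_mul' (x : CrossedProduct f) : 1 * x = x := by
  induction x using induction_on with
  | h0 => simp only [mul_zero']
  | ha x x' hx hx' => simp only [mul_add', hx, hx']
  | hs g s =>
    rw [one_def', mk_mul_mk, cocycle_one_left, one_mul, one_smul, mul_right_comm, Units.inv_mul,
      one_mul]

theorem mul_one' (x : CrossedProduct f) : x * 1 = x := by
  induction x using induction_on with
  | h0 => simp only [zero_mul']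
  | ha x x' hx hx' => simp only [add_mul', hx, hx']
  | hs g s =>
    rw [one_def', mk_mul_mk, cocycle_one_right, mul_one, mul_assoc, ← smul_mul', Units.inv_mul,
      smul_one, mul_one]

noncomputable instance : Ring (CrossedProduct f) where
  __ := (inferInstance : AddCommGroup (CrossedProduct f))
  mul_assoc := mul_assoc' f
  one_mul := one_mul' f
  mul_one := mul_one' f
  left_distrib := mul_add' f
  right_distrib := add_mul' f
  zero_mul := zero_mul' f
  mul_zero := mul_zero' f

theorem smul_mk {R : Type*} [CommRing R] [Algebra R A] (r : R) (g : G) (s : A) :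
    r • mk f g s = mk f g (r • s) :=
  Finsupp.smul_single r g s

/-- If the elements of `R` are fixed by `G`, then `R` acts centrally on `A^f * G`, which thus is
an `R`-algebra; `r • (s U_g) = (r s) U_g`. -/
noncomputable instance {R : Type*} [CommRing R] [Algebra R A] [SMulCommClass G R A] :
    Algebra R (CrossedProduct f) :=
  Algebra.ofModule
    (by
      intro r x y
      induction x using induction_on with
      | h0 => simp
      | ha x x' hx hx' => rw [smul_add, add_mul, add_mul, smul_add, hx, hx']
      | hs g s =>
        induction y using induction_on with
        | h0 => simp
        | ha y y' hy hy' => rw [mul_add, mul_add, smul_add, hy, hy']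
        | hs h t => simp only [smul_mk, mk_mul_mk, smul_mul_assoc])
    (by
      intro r x y
      induction x using induction_on with
      | h0 => simp
      | ha x x' hx hx' => rw [add_mul, add_mul, smul_add, hx, hx']
      | hs g s =>
        induction y using induction_on with
        | h0 => simp
        | ha y y' hy hy' => rw [smul_add, mul_add, mul_add, smul_add, hy, hy']
        | hs h t =>
          simp only [smul_mk, mk_mul_mk, smul_comm g r t, mul_smul_comm, smul_mul_assoc])

end Ring

section BaseChange

variable {G A : Type*} [Group G] [CommRing A] [MulSemiringAction G A] (f : TwoCocycle G A)
  (R : Type*) [CommRing R] [Algebra R A] [SMulCommClass G R A]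
  (B : Type*) [CommRing B] [MulSemiringAction G B] [Algebra A B] [SMulDistribClass G A B]
  [Algebra R B] [SMulCommClass G R B] [IsScalarTower R A B]

/-- The additive map underlying `CrossedProduct.toBaseChange`. -/
noncomputable def toBaseChangeAux : CrossedProduct f →+ CrossedProduct (f.baseChange B) :=
  Finsupp.mapRange.addMonoidHom (algebraMap A B).toAddMonoidHom

theorem toBaseChangeAux_mk (g : G) (s : A) :
    toBaseChangeAux f B (mk f g s) = mk (f.baseChange B) g (algebraMap A B s) :=
  Finsupp.mapRange_single (hf := map_zero (algebraMap A B))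

/-- The natural homomorphism of `R`-algebras `A^f * G → B^f * G`, `s U_g ↦ s U_g`. -/
noncomputable def toBaseChange : CrossedProduct f →ₐ[R] CrossedProduct (f.baseChange B) :=
  AlgHom.ofLinearMap
    { toBaseChangeAux f B with
      map_smul' := by
        intro r x
        change toBaseChangeAux f B (r • x) = r • toBaseChangeAux f B x
        induction x using induction_on with
        | h0 => simp
        | ha x x' hx hx' => rw [smul_add, map_add, map_add, smul_add, hx, hx']
        | hs g s =>
          rw [smul_mk, toBaseChangeAux_mk, toBaseChangeAux_mk, smul_mk, Algebra.smul_def,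
            map_mul, Algebra.smul_def, ← IsScalarTower.algebraMap_apply] }
    (by
      change toBaseChangeAux f B 1 = 1
      rw [one_def', one_def', toBaseChangeAux_mk]
      rfl)
    (by
      intro x y
      change toBaseChangeAux f B (x * y) = toBaseChangeAux f B x * toBaseChangeAux f B y
      induction x using induction_on with
      | h0 => simp
      | ha x x' hx hx' => rw [add_mul, map_add, map_add, add_mul, hx, hx']
      | hs g s =>
        induction y using induction_on with
        | h0 => simp
        | ha y y' hy hy' => rw [mul_add, map_add, map_add, mul_add, hy, hy']
        | hs h t =>
          have e : g • algebraMap A B t = algebraMap A B (g • t) := by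
            rw [Algebra.algebraMap_eq_smul_one, smul_distrib_smul, smul_one,
              ← Algebra.algebraMap_eq_smul_one]
          rw [mk_mul_mk, toBaseChangeAux_mk, toBaseChangeAux_mk, toBaseChangeAux_mk, mk_mul_mk,
            e, map_mul (algebraMap A B), map_mul (algebraMap A B)]
          rfl)

end BaseChange

end CrossedProduct

/-- If `A → B` is `G`-equivariant, the action of `G` on `B` is linear over the ring of invariants
`A^G`. -/
instance FixedPoints.smulCommClass_subring_of_smulDistribClass (G A B : Type*) [Group G]
    [CommRing A] [MulSemiringAction G A] [CommRing B] [MulSemiringAction G B] [Algebra A B]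
    [SMulDistribClass G A B] : SMulCommClass G (FixedPoints.subring A G) B where
  smul_comm g r b := by
    change g • ((r : A) • b) = (r : A) • (g • b)
    rw [smul_distrib_smul, r.2 g]

/-- A ring is hereditary if all its left ideals and all its right ideals are projective. -/
def IsHereditaryRing (T : Type*) [Ring T] : Prop :=
  (∀ I : Submodule T T, Module.Projective T I) ∧
    ∀ I : Submodule Tᵐᵒᵖ T, Module.Projective Tᵐᵒᵖ I

/-- For a domain `R` with field of fractions `K` and a `K`-algebra `E`, an `R`-order in `E` is a
subring `Λ` of `E` containing `R` that is finitely generated as an `R`-module and such that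
`K Λ = E`, that is, every element of `E` has a nonzero `R`-multiple in `Λ`. -/
def IsOrderIn (R : Type*) [CommRing R] {E : Type*} [Ring E] [Algebra R E] (Λ : Subalgebra R E) :
    Prop :=
  (Subalgebra.toSubmodule Λ).FG ∧ ∀ x : E, ∃ r : R, r ≠ 0 ∧ r • x ∈ Λ

/-- A maximal `R`-order in `E`: an `R`-order that is not properly contained in another one. -/
def IsMaximalOrderIn (R : Type*) [CommRing R] {E : Type*} [Ring E] [Algebra R E]
    (Λ : Subalgebra R E) : Prop :=
  Maximal (IsOrderIn R) Λ

/-- For a group `G` acting on a local ring `S` with maximal ideal `M`, the group of all `σ ∈ G`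
with `σ s ≡ s` mod `M ^ n` for all `s ∈ S`: for `n = 1` this is the inertia group (the kernel of
the action on the residue field), for `n = 2` the second ramification group. -/
def ramificationGroup (G S : Type*) [CommRing S] [IsLocalRing S] [Group G]
    [MulSemiringAction G S] (n : ℕ) : Subgroup G :=
  (IsLocalRing.maximalIdeal S ^ n).inertia G

/-- The extension of the residue field `S/M` of a local ring `S` over the residue field
`R/(M ∩ R)` of the ring of invariants `R = S^G` is separable (algebraic). -/
def IsResiduallySeparable (G S : Type*) [CommRing S] [IsLocalRing S] [Group G]
    [MulSemiringAction G S] : Prop :=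
  Algebra.IsSeparable
    (FixedPoints.subring S G ⧸
      (IsLocalRing.maximalIdeal S).under (FixedPoints.subring S G))
    (S ⧸ IsLocalRing.maximalIdeal S)

/-! The tame character σ ↦ σ(π)/π embeds G_I/P in the units of the residue field, so this quotient
is cyclic of order prime to p; separability makes the kernel exactly P. As P is a p-group,
everything follows once P is central in G_I: a group that is cyclic modulo a central subgroup is
abelian, and Schur–Zassenhaus splits off a complement of P.

Centrality is where T enters. Let T_P = S^f * P, and let J be its set of nonunits. The determinant
of right multiplication is a multiplicative norm T_P → S that detects units. As P is a p-group
acting trivially on the residue field, the norm is additive modulo M_S (`map_norm_add`), so J is the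
kernel of a ring homomorphism and T_P is local. Norms are P-invariant, and an invariant nonunit has
valuation at least |P| (`pow_card_dvd_of_invariant`), whereas the norm of π has valuation exactly
|P|; so π is not a product of two nonunits (`isUnit_of_mul_eq_smul_one`).

J is stable under conjugation by the U_g and generates a two-sided ideal I of T. If T is hereditary,
a dual basis of I yields a linear form J → T_P with a unit value; if T is a maximal order, such a
form comes from the fact that the right order of I is T. Together with the irreducibility of π, the
form forces J = πT_P (`exists_eq_smul_of_linearMap`). For c in G_I and g in P, the elements U_g and
U_c U_g U_c⁻¹ agree modulo J because their |P|-th powers do. Their difference is thus divisible by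
π, which is impossible if they lie in different components S U_h (`mul_eq_mul_of_nonunitsIdeal`). -/

open IsLocalRing

/-! ### Counting fixed points modulo p. -/

/-- In characteristic `p`, the sum of an invariant function over a finite set with an action of a
`p`-group is its sum over the fixed points. -/
theorem IsPGroup.sum_eq_sum_fixedPoints {p : ℕ} [Fact p.Prime] {H : Type*} [Group H]
    (hH : IsPGroup p H) {α k : Type*} [Fintype α] [MulAction H α]
    [DecidablePred (· ∈ MulAction.fixedPoints H α)] [CommRing k] [CharP k p]
    (F : α → k) (hF : ∀ (h : H) (x : α), F (h • x) = F x) :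
    ∑ x, F x = ∑ x with x ∈ MulAction.fixedPoints H α, F x := by
  classical
  -- Grouping by values turns both sums into fibre counts; each fibre is stable under `H`, so its
  -- size is congruent mod p to the number of its fixed points.
  have hfib (s : Finset α) : ∑ x ∈ s, F x =
      ∑ c ∈ Finset.univ.image F, ((s.filter fun x => F x = c).card : k) * c := by
    rw [← Finset.sum_fiberwise_of_maps_to (s := s) (t := Finset.univ.image F) (g := F)
      fun x _ => Finset.mem_image_of_mem F (Finset.mem_univ x)]
    refine Finset.sum_congr rfl fun c _ => ?_
    rw [Finset.sum_congr rfl fun x hx => (Finset.mem_filter.mp hx).2, Finset.sum_const,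
      nsmul_eq_mul]
  rw [hfib, hfib]
  refine Finset.sum_congr rfl fun c _ => ?_
  congr 1
  let Y : SubMulAction H α := ⟨{x | F x = c}, fun h x hx => (hF h x).trans hx⟩
  have h1 := hH.card_modEq_card_fixedPoints Y
  have h2 : Nat.card Y = ((Finset.univ : Finset α).filter fun x => F x = c).card := by
    refine Nat.subtype_card _ fun x => ?_
    simp only [Finset.mem_filter, Finset.mem_univ, true_and]
    rfl
  have h3 : Nat.card (MulAction.fixedPoints H Y) =
      (((Finset.univ : Finset α).filter fun x => x ∈ MulAction.fixedPoints H α).filter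
        fun x => F x = c).card := by
    have e : MulAction.fixedPoints H Y ≃ {x : α // x ∈ MulAction.fixedPoints H α ∧ F x = c} :=
      { toFun y := ⟨y.1.1, fun h => congrArg Subtype.val (y.2 h), y.1.2⟩
        invFun x := ⟨⟨x.1, x.2.2⟩, fun h => Subtype.ext (x.2.1 h)⟩
        left_inv _ := rfl
        right_inv _ := rfl }
    rw [Nat.card_congr e]
    refine Nat.subtype_card _ fun x => ?_
    simp only [Finset.mem_filter, Finset.mem_univ, true_and]
  rw [← h2, ← h3]
  exact (CharP.natCast_eq_natCast k p).mpr h1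

/-! ### Inertia group and residue field. -/

section LocalRing

variable {G S : Type*} [CommRing S] [IsLocalRing S] [Group G] [MulSemiringAction G S]

theorem smul_mem_maximalIdeal_pow (g : G) {n : ℕ} {x : S} (hx : x ∈ maximalIdeal S ^ n) :
    g • x ∈ maximalIdeal S ^ n := by
  have h : (maximalIdeal S).map (MulSemiringAction.toRingHom G S g) ≤ maximalIdeal S := by
    rw [Ideal.map_le_iff_le_comap]
    intro y hy
    rw [Ideal.mem_comap, mem_maximalIdeal, mem_nonunits_iff]
    intro hu
    have h2 := hu.map (MulSemiringAction.toRingHom G S g⁻¹)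
    simp only [MulSemiringAction.toRingHom_apply, inv_smul_smul] at h2
    exact hy h2
  have h2 := Ideal.mem_map_of_mem (MulSemiringAction.toRingHom G S g) hx
  rw [Ideal.map_pow] at h2
  exact Ideal.pow_right_mono h n h2

theorem smul_mem_maximalIdeal (g : G) {x : S} (hx : x ∈ maximalIdeal S) :
    g • x ∈ maximalIdeal S := by
  rw [← pow_one (maximalIdeal S)] at hx ⊢
  exact smul_mem_maximalIdeal_pow g hx

theorem mem_ramificationGroup {n : ℕ} {σ : G} :
    σ ∈ ramificationGroup G S n ↔ ∀ s : S, σ • s - s ∈ maximalIdeal S ^ n := Iff.rfl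

theorem mem_ramificationGroup_one {σ : G} :
    σ ∈ ramificationGroup G S 1 ↔ ∀ s : S, σ • s - s ∈ maximalIdeal S := by
  rw [mem_ramificationGroup, pow_one]

theorem ramificationGroup_antitone : Antitone (ramificationGroup G S) :=
  fun _ _ h _ hσ s => Ideal.pow_le_pow_right h (hσ s)

theorem ramificationGroup_normal (n : ℕ) : (ramificationGroup G S n).Normal where
  conj_mem σ hσ g s := by
    have h := smul_mem_maximalIdeal_pow g (hσ (g⁻¹ • s))
    rwa [smul_sub, smul_inv_smul, ← mul_smul, ← mul_smul] at h

open Polynomial in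
/-- If the residue extension `S̄/R̄` is separable, every residue class is represented by an element
fixed by the inertia group. -/
theorem exists_fixed_sub_mem_of_isResiduallySeparable [Finite G]
    (hsep : IsResiduallySeparable G S) (s : S) :
    ∃ r : S, (∀ σ ∈ ramificationGroup G S 1, σ • r = r) ∧ s - r ∈ maximalIdeal S := by
  classical
  have := Fintype.ofFinite (ramificationGroup G S 1)
  let H := ramificationGroup G S 1
  let k := S ⧸ maximalIdeal S
  let _ : Field k := Ideal.Quotient.field (maximalIdeal S)
  let K₀ : Subfield k :=
    { (FixedPoints.subring S H).map (Ideal.Quotient.mk (maximalIdeal S)) with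
      inv_mem' := by
        rintro _ ⟨x, hx, rfl⟩
        by_cases hu : IsUnit x
        · obtain ⟨u, rfl⟩ := hu
          refine ⟨((u⁻¹ : Sˣ) : S), fun σ => ?_, ?_⟩
          · have h1 : (u : S) * σ • ((u⁻¹ : Sˣ) : S) = (u : S) * ((u⁻¹ : Sˣ) : S) := by
              conv_lhs => rw [← hx σ]
              rw [← smul_mul', Units.mul_inv, smul_one]
            exact u.isUnit.mul_left_cancel h1
          · refine eq_inv_of_mul_eq_one_left ?_
            rw [← map_mul, Units.inv_mul, map_one]
        · have : Ideal.Quotient.mk (maximalIdeal S) x = 0 :=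
            Ideal.Quotient.eq_zero_iff_mem.mpr hu
          rw [this, inv_zero]
          exact ⟨0, (FixedPoints.subring S H).zero_mem, map_zero _⟩ }
  have hK (r : S) (hr : ∀ σ : H, σ • r = r) :
      Ideal.Quotient.mk (maximalIdeal S) r ∈ (algebraMap K₀ k).range :=
    ⟨⟨_, r, hr, rfl⟩, rfl⟩
  set a : k := Ideal.Quotient.mk (maximalIdeal S) s with ha
  -- a separable polynomial over `K₀` with root `a`
  obtain ⟨P, hP, hPa⟩ : ∃ P : K₀[X], P.Separable ∧ aeval a P = 0 := by
    let F₀ := FixedPoints.subring S G ⧸ (maximalIdeal S).under (FixedPoints.subring S G)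
    have h1 : (minpoly F₀ a).Separable := hsep.isSeparable' a
    have h2 : (minpoly F₀ a).map (algebraMap F₀ k) ∈ lifts (algebraMap K₀ k) := by
      rw [lifts_iff_coeff_lifts]
      intro n
      rw [coeff_map]
      obtain ⟨r, hr⟩ := Ideal.Quotient.mk_surjective ((minpoly F₀ a).coeff n)
      rw [← hr]
      exact hK r fun σ => r.2 σ
    obtain ⟨P, hP⟩ := (mem_lifts _).mp h2
    refine ⟨P, (separable_map (algebraMap K₀ k)).mp (hP ▸ h1.map), ?_⟩
    rw [aeval_def, ← eval_map, hP, eval_map, ← aeval_def, minpoly.aeval]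
  -- a power of `X - a` over `K₀`
  obtain ⟨Q, n, hn, hQ⟩ : ∃ (Q : K₀[X]) (n : ℕ), n ≠ 0 ∧ Q.map (algebraMap K₀ k) = (X - C a) ^ n := by
    -- The polynomial ∏ (X - σ s) over the inertia group has invariant coefficients, and all its
    -- roots reduce to `a`.
    have h2 : (MulSemiringAction.charpoly H s).map (Ideal.Quotient.mk (maximalIdeal S)) ∈
        lifts (algebraMap K₀ k) := by
      rw [lifts_iff_coeff_lifts]
      intro n
      rw [coeff_map]
      exact hK _ fun σ => MulSemiringAction.smul_coeff_charpoly s n σ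
    obtain ⟨Q, hQ⟩ := (mem_lifts _).mp h2
    refine ⟨Q, Fintype.card H, Fintype.card_ne_zero, ?_⟩
    rw [hQ, MulSemiringAction.charpoly_eq, Polynomial.map_prod,
      Finset.prod_congr rfl (g := fun _ => X - C a), Finset.prod_const, Finset.card_univ]
    intro σ _
    rw [Polynomial.map_sub, map_X, map_C, ha]
    congr 2
    exact Ideal.Quotient.eq.mpr (mem_ramificationGroup_one.mp σ.2 s)
  have hQa : aeval a Q = 0 := by
    rw [aeval_def, ← eval_map, hQ]
    simp [hn]
  have hint : IsIntegral K₀ a := by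
    refine ⟨Q, ?_, hQa⟩
    refine monic_of_injective (algebraMap K₀ k).injective ?_
    rw [hQ]
    exact (monic_X_sub_C a).pow n
  have hm1 : ((minpoly K₀ a).map (algebraMap K₀ k)).Separable := (hP.of_dvd (minpoly.dvd _ _ hPa)).map
  have hm2 : (minpoly K₀ a).map (algebraMap K₀ k) ∣ (X - C a) ^ n :=
    hQ ▸ Polynomial.map_dvd _ (minpoly.dvd _ _ hQa)
  -- A separable divisor of a power of X - a has degree at most one, so `a` already lies in `K₀`.
  have hdeg : (minpoly K₀ a).natDegree = 1 := by
    obtain ⟨i, -, hi⟩ := (dvd_prime_pow (prime_X_sub_C a) n).mp hm2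
    have h3 := hi.symm.dvd
    have h4 : (minpoly K₀ a).natDegree = i := by
      rw [← natDegree_map (algebraMap K₀ k), natDegree_eq_of_degree_eq (degree_eq_degree_of_associated hi),
        natDegree_pow, natDegree_X_sub_C, mul_one]
    have h5 := minpoly.natDegree_pos hint
    by_contra hne
    have h6 : (X - C a) * (X - C a) ∣ (minpoly K₀ a).map (algebraMap K₀ k) := by
      rw [← sq]
      exact (pow_dvd_pow _ (by omega)).trans h3
    exact not_isUnit_X_sub_C a (hm1.squarefree _ h6)
  obtain ⟨⟨_, r, hr, rfl⟩, hr'⟩ := minpoly.natDegree_eq_one_iff.mp hdeg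
  exact ⟨r, fun σ hσ => hr ⟨σ, hσ⟩, Ideal.Quotient.eq.mp hr'.symm⟩

end LocalRing

/-! ### The second ramification group is a p-group. -/

section LocalRing

variable {G S : Type*} [CommRing S] [IsLocalRing S] [Group G] [MulSemiringAction G S]

/-- Elements of P act trivially on every M^i/M^(i+1), by the twisted Leibniz rule for σ - 1. -/
theorem smul_sub_mem_pow_succ {σ : G} (hσ : σ ∈ ramificationGroup G S 2) (i : ℕ) {x : S}
    (hx : x ∈ maximalIdeal S ^ i) : σ • x - x ∈ maximalIdeal S ^ (i + 1) := by
  induction i generalizing x with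
  | zero => exact Ideal.pow_le_pow_right one_le_two (hσ x)
  | succ i ih =>
    rw [pow_succ] at hx
    refine Submodule.mul_induction_on hx (fun y hy z hz => ?_) fun y z hy hz => ?_
    · have e : σ • (y * z) - y * z = (σ • y - y) * σ • z + y * (σ • z - z) := by
        rw [smul_mul']
        ring
      rw [e]
      refine add_mem ?_ ?_
      · rw [pow_succ]
        exact Ideal.mul_mem_mul (ih hy) (smul_mem_maximalIdeal σ hz)
      · rw [add_assoc, pow_add]
        exact Ideal.mul_mem_mul hy (hσ z)
    · have e : σ • (y + z) - (y + z) = (σ • y - y) + (σ • z - z) := by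
        rw [smul_add]
        ring
      rw [e]
      exact add_mem hy hz

theorem eq_one_of_forall_smul_sub_mem_pow [IsNoetherianRing S] [FaithfulSMul G S] {σ : G}
    (h : ∀ (i : ℕ) (s : S), σ • s - s ∈ maximalIdeal S ^ i) : σ = 1 := by
  refine FaithfulSMul.eq_of_smul_eq_smul (α := S) fun s => ?_
  rw [one_smul, ← sub_eq_zero, ← Ideal.mem_bot,
    ← Ideal.iInf_pow_eq_bot_of_isLocalRing _ (maximalIdeal.isMaximal S).ne_top, Ideal.mem_iInf]
  exact fun i => h i s

/-- If d = σs - s lies in M^i for every s, the telescoping sum of the σ^j d over j < m vanishes,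
while each term is d modulo M^(i+1). Hence m d, and so d, lies in M^(i+1); Krull's intersection
theorem concludes. -/
theorem eq_one_of_mem_ramificationGroup_two_of_pow_eq_one [IsNoetherianRing S] [FaithfulSMul G S]
    {σ : G} (hσ : σ ∈ ramificationGroup G S 2) {m : ℕ} (hm : σ ^ m = 1)
    (hmu : IsUnit (m : S)) : σ = 1 := by
  refine eq_one_of_forall_smul_sub_mem_pow (S := S) fun i => ?_
  induction i with
  | zero => simp
  | succ i ih =>
    intro s
    have h1 := Finset.sum_range_sub (fun j => σ ^ j • s) m
    simp only [hm, pow_zero, sub_self] at h1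
    have h2 : ∑ j ∈ Finset.range m, (σ ^ j • (σ • s - s) - (σ • s - s)) ∈
        maximalIdeal S ^ (i + 1) :=
      Ideal.sum_mem _ fun j _ =>
        smul_sub_mem_pow_succ ((ramificationGroup G S 2).pow_mem hσ j) i (ih s)
    rw [Finset.sum_sub_distrib, Finset.sum_congr rfl (g := fun j => σ ^ (j + 1) • s - σ ^ j • s)
      (fun j _ => by rw [smul_sub, ← mul_smul, ← pow_succ]), h1, Finset.sum_const,
      Finset.card_range, zero_sub, neg_mem_iff, nsmul_eq_mul] at h2
    obtain ⟨u, hu⟩ := hmu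
    rw [← hu] at h2
    simpa using Ideal.mul_mem_left _ ((u⁻¹ : Sˣ) : S) h2

theorem isUnit_natCast_of_coprime (p : ℕ) [ExpChar (ResidueField S) p] {m : ℕ} (hm0 : m ≠ 0)
    (hm : m.Coprime p) : IsUnit (m : S) := by
  by_contra h
  have h1 : residue S (m : S) = 0 := (residue_eq_zero_iff _).mpr h
  rw [map_natCast] at h1
  rcases ‹ExpChar (ResidueField S) p› with _ | hp
  · exact hm0 (Nat.cast_eq_zero.mp h1)
  · rw [CharP.cast_eq_zero_iff (ResidueField S) p] at h1
    exact hp.one_lt.ne' (Nat.dvd_one.mp (hm ▸ Nat.dvd_gcd h1 dvd_rfl))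

theorem isPGroup_ramificationGroup_two [IsNoetherianRing S] [FaithfulSMul G S] [Finite G]
    (p : ℕ) [ExpChar (ResidueField S) p] : IsPGroup p (ramificationGroup G S 2) := by
  rw [isPGroup_iff_pow_pow_eq_one]
  rintro ⟨σ, hσ⟩
  have h0 : orderOf σ ≠ 0 := (orderOf_pos σ).ne'
  -- The power σ^(p^k) is killed by m, a unit of `S`, hence is trivial. For p = 1 take k = 0: the
  -- group itself is trivial.
  have key (k m : ℕ) (hkm : orderOf σ = p ^ k * m) (hm : m.Coprime p) :
      ∃ k, (⟨σ, hσ⟩ : ramificationGroup G S 2) ^ p ^ k = 1 := by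
    refine ⟨k, Subtype.ext ?_⟩
    refine eq_one_of_mem_ramificationGroup_two_of_pow_eq_one (S := S) (m := m) (pow_mem hσ _) ?_
      (isUnit_natCast_of_coprime p ?_ hm)
    · rw [SubgroupClass.coe_pow, ← pow_mul, ← hkm, pow_orderOf_eq_one]
    · rintro rfl
      exact h0 hkm
  rcases expChar_is_prime_or_one (ResidueField S) p with hp | rfl
  · obtain ⟨k, m, hm, e⟩ := Nat.exists_eq_pow_mul_and_not_dvd h0 p hp.ne_one
    exact key k m e ((Nat.Prime.coprime_iff_not_dvd hp).mpr hm).symm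
  · exact key 0 (orderOf σ) (by simp) (Nat.coprime_one_right _)

end LocalRing

/-! ### Tame character, and valuations of invariants. -/

section DVR

variable {G S : Type*} [CommRing S] [IsDomain S] [IsDiscreteValuationRing S] [Group G]
  [MulSemiringAction G S]

theorem mem_maximalIdeal_pow_iff_dvd {π : S} (hπ : Irreducible π) (n : ℕ) (x : S) :
    x ∈ maximalIdeal S ^ n ↔ π ^ n ∣ x := by
  rw [hπ.maximalIdeal_eq, Ideal.span_singleton_pow, Ideal.mem_span_singleton]

theorem mem_maximalIdeal_iff_dvd {π : S} (hπ : Irreducible π) (x : S) :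
    x ∈ maximalIdeal S ↔ π ∣ x := by
  rw [hπ.maximalIdeal_eq, Ideal.mem_span_singleton]

/-- Write s = r + πt with r fixed by inertia: modulo M², σs - s is then controlled by σπ - π alone.
This identifies the kernel of the tame character. -/
theorem mem_ramificationGroup_two_of_smul_sub_mem
    (hres : ∀ s : S, ∃ r : S, (∀ σ ∈ ramificationGroup G S 1, σ • r = r) ∧
      s - r ∈ maximalIdeal S) {π : S} (hπ : Irreducible π) {σ : G}
    (hσ : σ ∈ ramificationGroup G S 1) (h : σ • π - π ∈ maximalIdeal S ^ 2) :
    σ ∈ ramificationGroup G S 2 := by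
  intro s
  obtain ⟨r, hr, hsr⟩ := hres s
  obtain ⟨t, ht⟩ := (mem_maximalIdeal_iff_dvd hπ _).mp hsr
  have e : σ • s - s = (σ • π - π) * σ • t + π * (σ • t - t) := by
    obtain rfl : s = r + π * t := by rw [← ht]; ring
    rw [smul_add, hr σ hσ, smul_mul']
    ring
  rw [e]
  refine add_mem (Ideal.mul_mem_right _ _ h) ?_
  rw [pow_two]
  exact Ideal.mul_mem_mul ((mem_maximalIdeal_iff_dvd hπ _).mpr dvd_rfl)
    (mem_ramificationGroup_one.mp hσ t)

theorem exists_smul_eq_mul_irreducible {π : S} (hπ : Irreducible π) (g : G) :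
    ∃ u : Sˣ, g • π = u * π := by
  have h (g : G) : π ∣ g • π := (mem_maximalIdeal_iff_dvd hπ _).mp
    (smul_mem_maximalIdeal g ((mem_maximalIdeal_iff_dvd hπ _).mpr dvd_rfl))
  have h2 : g • π ∣ π := by
    obtain ⟨c, hc⟩ := h g⁻¹
    refine ⟨g • c, ?_⟩
    rw [← smul_mul', ← hc, smul_inv_smul]
  obtain ⟨u, hu⟩ := associated_of_dvd_dvd (h g) h2
  exact ⟨u, by rw [← hu, mul_comm]⟩

/-- The tame character `σ ↦ σ(π)/π` of the inertia group. -/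
theorem exists_tame_character
    (hres : ∀ s : S, ∃ r : S, (∀ σ ∈ ramificationGroup G S 1, σ • r = r) ∧
      s - r ∈ maximalIdeal S) :
    ∃ θ : ramificationGroup G S 1 →* (ResidueField S)ˣ,
      θ.ker = (ramificationGroup G S 2).subgroupOf (ramificationGroup G S 1) := by
  obtain ⟨π, hπ⟩ := IsDiscreteValuationRing.exists_irreducible S
  choose u hu using fun g : G => exists_smul_eq_mul_irreducible hπ g
  let θ₀ : ramificationGroup G S 1 →* ResidueField S :=
    { toFun σ := residue S (u σ)
      map_one' := by
        have : (u 1 : S) = 1 := by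
          have h := hu 1
          rw [one_smul] at h
          exact (mul_right_cancel₀ hπ.ne_zero ((one_mul π).trans h)).symm
        rw [Subgroup.coe_one, this, map_one]
      map_mul' σ τ := by
        -- A priori σ ↦ σ(π)/π is only a crossed homomorphism; inertia acts trivially on the residue
        -- field, so its reduction is a homomorphism.
        have h : (u (σ * τ) : S) = (σ : G) • (u τ : S) * u σ := by
          refine mul_right_cancel₀ hπ.ne_zero ?_
          rw [← hu, mul_smul, hu, smul_mul', hu, mul_assoc]
        have h2 : residue S ((σ : G) • (u τ : S)) = residue S (u τ) :=
          Ideal.Quotient.eq.mpr (mem_ramificationGroup_one.mp σ.2 _)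
        rw [Subgroup.coe_mul, h, map_mul, h2, mul_comm] }
  refine ⟨θ₀.toHomUnits, ?_⟩
  ext σ
  rw [MonoidHom.mem_ker, Subgroup.mem_subgroupOf, Units.ext_iff]
  have h1 : ((θ₀.toHomUnits σ : (ResidueField S)ˣ) : ResidueField S) = residue S (u σ) := rfl
  have h2 : residue S (u σ) = 1 ↔ (u σ : S) - 1 ∈ maximalIdeal S := by
    rw [← map_one (residue S)]
    exact Ideal.Quotient.eq
  have h3 : (σ : G) • π - π = π * ((u σ : S) - 1) := by
    rw [hu]
    ring
  have h4 : (u σ : S) - 1 ∈ maximalIdeal S ↔ (σ : G) • π - π ∈ maximalIdeal S ^ 2 := by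
    rw [h3, mem_maximalIdeal_pow_iff_dvd hπ, pow_two, mul_dvd_mul_iff_left hπ.ne_zero,
      mem_maximalIdeal_iff_dvd hπ]
  rw [h1, Units.val_one, h2, h4]
  exact ⟨mem_ramificationGroup_two_of_smul_sub_mem hres hπ σ.2, fun h => h π⟩

/-- A nonzero ideal is generated by an element of least valuation, since quotients of invariants in
`S` are invariant. It provides the noetherian base ring for the maximal-order case. -/
instance isPrincipalIdealRing_fixedPoints : IsPrincipalIdealRing (FixedPoints.subring S G) where
  principal I := by
    obtain ⟨π, hπ⟩ := IsDiscreteValuationRing.exists_irreducible S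
    by_cases hI : I = ⊥
    · exact hI ▸ inferInstance
    classical
    have hex : ∃ n : ℕ, ∃ a ∈ I, a ≠ 0 ∧ Associated (a : S) (π ^ n) := by
      obtain ⟨a, ha, ha0⟩ := Submodule.exists_mem_ne_zero_of_ne_bot hI
      obtain ⟨n, hn⟩ := IsDiscreteValuationRing.associated_pow_irreducible
        (x := (a : S)) (by simpa using ha0) hπ
      exact ⟨n, a, ha, ha0, hn⟩
    obtain ⟨a, ha, ha0, hassoc⟩ := Nat.find_spec hex
    have ha0' : (a : S) ≠ 0 := by simpa using ha0
    refine ⟨a, le_antisymm (fun b hb => ?_) ((Ideal.span_singleton_le_iff_mem I).mpr ha)⟩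
    rw [Ideal.submodule_span_eq, Ideal.mem_span_singleton]
    by_cases hb0 : b = 0
    · exact hb0 ▸ dvd_zero a
    obtain ⟨n, hn⟩ := IsDiscreteValuationRing.associated_pow_irreducible
      (x := (b : S)) (by simpa using hb0) hπ
    have h1 : (a : S) ∣ b := hassoc.dvd.trans
      ((pow_dvd_pow π (Nat.find_le ⟨b, hb, hb0, hn⟩)).trans hn.symm.dvd)
    obtain ⟨c, hc⟩ := h1
    refine ⟨⟨c, fun g => ?_⟩, Subtype.ext hc⟩
    refine mul_left_cancel₀ ha0' ?_
    rw [← hc]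
    conv_rhs => rw [← b.2 g, hc, smul_mul', a.2 g]

/-- If `G` acts trivially on the residue field and every residue class contains an invariant
element, then an invariant nonunit has valuation at least `|G|`. -/
theorem pow_card_dvd_of_invariant [Finite G] [FaithfulSMul G S]
    (hres : ∀ s : S, ∃ r : S, (∀ σ : G, σ • r = r) ∧ s - r ∈ maximalIdeal S)
    {π : S} (hπ : Irreducible π) {a : S} (ha : ∀ σ : G, σ • a = a) (haM : a ∈ maximalIdeal S) :
    π ^ Nat.card G ∣ a := by
  by_cases ha0 : a = 0
  · exact ha0 ▸ dvd_zero _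
  obtain ⟨e, he⟩ := IsDiscreteValuationRing.associated_pow_irreducible ha0 hπ
  -- If the valuation e of `a` were below |G|, then modulo every power of `a` the ring would be
  -- spanned over the invariants by e powers of π, and π would have too many conjugates.
  by_contra hlt
  have hlt : e < Nat.card G := by
    by_contra h
    exact hlt ((pow_dvd_pow π (not_lt.mp h)).trans he.symm.dvd)
  -- `S = ∑_{i < e} R π^i + a^N S`
  have step1 (j : ℕ) (s : S) : ∃ c : ℕ → S, (∀ i (σ : G), σ • c i = c i) ∧
      π ^ j ∣ s - ∑ i ∈ Finset.range j, c i * π ^ i := by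
    induction j generalizing s with
    | zero => exact ⟨fun _ => 0, fun _ σ => smul_zero σ, by simp⟩
    | succ j ih =>
      obtain ⟨r, hr, hsr⟩ := hres s
      obtain ⟨t, ht⟩ := (mem_maximalIdeal_iff_dvd hπ _).mp hsr
      obtain ⟨c, hc, w, hw⟩ := ih t
      refine ⟨fun i => if i = 0 then r else c (i - 1), fun i σ => ?_, w, ?_⟩
      · dsimp only
        split_ifs
        exacts [hr σ, hc _ σ]
      · rw [Finset.sum_range_succ']
        simp only [Nat.add_eq_zero_iff, one_ne_zero, and_false, if_false, Nat.add_sub_cancel,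
          if_true, pow_zero, mul_one]
        have e1 : ∑ i ∈ Finset.range j, c i * π ^ (i + 1) =
            π * ∑ i ∈ Finset.range j, c i * π ^ i := by
          rw [Finset.mul_sum]
          exact Finset.sum_congr rfl fun i _ => by ring
        rw [e1, pow_succ']
        linear_combination ht + π * hw
  have step2 (N : ℕ) (s : S) : ∃ c : ℕ → S, (∀ i (σ : G), σ • c i = c i) ∧
      a ^ N ∣ s - ∑ i ∈ Finset.range e, c i * π ^ i := by
    induction N generalizing s with
    | zero => exact ⟨fun _ => 0, fun _ σ => smul_zero σ, by simp⟩
    | succ N ih =>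
      obtain ⟨c, hc, hd⟩ := step1 e s
      -- `a` is associated to π^e, so the remainder is a multiple of `a` and its quotient can be
      -- expanded again.
      obtain ⟨t, ht⟩ := he.dvd.trans hd
      obtain ⟨c', hc', w, hw⟩ := ih t
      refine ⟨fun i => c i + a * c' i, fun i σ => ?_, w, ?_⟩
      · rw [smul_add, smul_mul', hc, hc', ha]
      · have e1 : ∑ i ∈ Finset.range e, (c i + a * c' i) * π ^ i =
            ∑ i ∈ Finset.range e, c i * π ^ i + a * ∑ i ∈ Finset.range e, c' i * π ^ i := by
          rw [Finset.mul_sum, ← Finset.sum_add_distrib]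
          exact Finset.sum_congr rfl fun i _ => by ring
        rw [e1, pow_succ']
        linear_combination ht + a * hw
  have hNM (N : ℕ) {x : S} (hx : a ^ N ∣ x) : x ∈ maximalIdeal S ^ N :=
    Ideal.mem_of_dvd _ hx (Ideal.pow_mem_pow haM N)
  have hdist : Function.Injective fun σ : G => σ • π := by
    intro σ τ hστ
    rw [← inv_mul_eq_one, ← one_mul (σ⁻¹ * τ)]
    have hfix : (σ⁻¹ * τ) • π = π := by
      have hστ' : σ • π = τ • π := hστ
      rw [mul_smul, ← hστ', inv_smul_smul]
    rw [one_mul]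
    -- An element of `G` that fixes π fixes every s modulo a^N, by the expansion of s.
    refine eq_one_of_forall_smul_sub_mem_pow (S := S) fun N s => ?_
    obtain ⟨c, hc, w, hw⟩ := step2 N s
    obtain rfl : s = ∑ i ∈ Finset.range e, c i * π ^ i + a ^ N * w := by rw [← hw]; ring
    refine hNM N ⟨(σ⁻¹ * τ) • w - w, ?_⟩
    rw [smul_add, Finset.smul_sum, smul_mul', smul_pow', ha,
      Finset.sum_congr rfl fun i _ => by rw [smul_mul', smul_pow', hfix, hc]]
    ring
  -- the Vandermonde determinant of the conjugates of `π` vanishes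
  let ε := Finite.equivFin G
  let v : Fin (Nat.card G) → S := fun i => ε.symm i • π
  have hv : Function.Injective v := hdist.comp ε.symm.injective
  refine Matrix.det_vandermonde_ne_zero_iff.mpr hv ?_
  rw [← Ideal.mem_bot,
    ← Ideal.iInf_pow_eq_bot_of_isLocalRing _ (maximalIdeal.isMaximal S).ne_top, Ideal.mem_iInf]
  intro N
  -- A monic polynomial of degree e with invariant coefficients vanishes modulo a^N at π, hence at
  -- all conjugates of π. `x` is its coefficient vector, padded by zeros; e < |G| leaves room for
  -- the leading 1.
  obtain ⟨c, hc, w, hw⟩ := step2 N (π ^ e)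
  let x : Fin (Nat.card G) → S := fun i => if (i : ℕ) = e then 1 else if (i : ℕ) < e then - c i else 0
  have hx : (Matrix.vandermonde v).mulVec x = fun i => a ^ N * ε.symm i • w := by
    funext i
    rw [Matrix.mulVec, dotProduct]
    simp only [Matrix.vandermonde_apply]
    rw [Fin.sum_univ_eq_sum_range (fun j => v i ^ j *
      if j = e then (1 : S) else if j < e then - c j else 0) (Nat.card G),
      ← Finset.sum_subset (Finset.range_mono hlt) fun j _ hj => ?_, Finset.sum_range_succ,
      Finset.sum_congr rfl (g := fun j => - (c j * v i ^ j)) fun j hj => ?_]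
    · have h1 := congrArg (fun y => ε.symm i • y) hw
      simp only [smul_sub, smul_mul', smul_pow', ha, Finset.smul_sum, hc] at h1
      rw [← h1, if_pos rfl, Finset.sum_neg_distrib]
      ring
    · have := Finset.mem_range.mp hj
      rw [if_neg this.ne, if_pos this]
      ring
    · have := Finset.mem_range.not.mp hj
      rw [if_neg (by omega), if_neg (by omega), mul_zero]
  -- Multiplying by the adjugate isolates the determinant in coordinate e, where `x` is 1.
  have hdet := congrArg (fun y => (Matrix.vandermonde v).adjugate.mulVec y ⟨e, hlt⟩) hx
  simp only [Matrix.mulVec_mulVec, Matrix.adjugate_mul, Matrix.smul_mulVec, Matrix.one_mulVec] at hdet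
  have hxe : x ⟨e, hlt⟩ = 1 := by simp [x]
  rw [Pi.smul_apply, hxe, smul_eq_mul, mul_one] at hdet
  rw [hdet]
  refine hNM N ?_
  rw [Matrix.mulVec, dotProduct]
  exact Finset.dvd_sum fun i _ => (Dvd.intro _ rfl).mul_left _

end DVR

/-! ### The norm of a crossed product. -/

namespace CrossedProduct

section Norm

variable {G A : Type*} [Group G] [CommRing A] [MulSemiringAction G A] {f : TwoCocycle G A}

theorem coeff_mk_apply [DecidableEq G] (g h : G) (s : A) :
    coeff (mk f g s) h = if g = h then s else 0 := by
  rw [coeff_mk, Finsupp.single_apply]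

theorem ext_coeff {x y : CrossedProduct f} (h : ∀ g, coeff x g = coeff y g) : x = y :=
  coeff.injective (Finsupp.ext h)

theorem coeff_smul_apply (s : A) (x : CrossedProduct f) (g : G) :
    coeff (s • x) g = s * coeff x g := rfl

theorem smul_one_eq (s : A) :
    s • (1 : CrossedProduct f) = mk f 1 (s * ((f.toFun 1 1)⁻¹ : Aˣ)) := by
  rw [one_def', smul_mk, smul_eq_mul]

theorem smul_mul (s : A) (x y : CrossedProduct f) : (s • x) * y = s • (x * y) := by
  induction x using induction_on with
  | h0 => simp
  | ha x x' hx hx' => rw [smul_add, add_mul, add_mul, smul_add, hx, hx']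
  | hs g s' =>
    induction y using induction_on with
    | h0 => simp
    | ha y y' hy hy' => rw [mul_add, mul_add, smul_add, hy, hy']
    | hs h t => simp only [smul_mk, mk_mul_mk, smul_mul_assoc]

instance isScalarTower_self : IsScalarTower A (CrossedProduct f) (CrossedProduct f) :=
  ⟨fun s x y => smul_mul s x y⟩

theorem mk_mul_smul (g : G) (s a : A) (x : CrossedProduct f) :
    mk f g s * (a • x) = (g • a) • (mk f g s * x) := by
  induction x using induction_on with
  | h0 => simp
  | ha x x' hx hx' => simp only [smul_add, mul_add, hx, hx']
  | hs h t =>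
    simp only [smul_mk, mk_mul_mk, smul_eq_mul, smul_mul']
    congr 1
    ring

theorem mul_smul_of_invariant {a : A} (ha : ∀ g : G, g • a = a)
    (x y : CrossedProduct f) :
    x * (a • y) = a • (x * y) := by
  induction x using induction_on with
  | h0 => simp
  | ha x x' hx hx' => rw [add_mul, add_mul, smul_add, hx, hx']
  | hs g s => rw [mk_mul_smul, ha g]

variable [Fintype G] [DecidableEq G]

variable (f) in
/-- The matrix of right multiplication by an element of the crossed product with respect to the
left basis `(U_g)`. -/
noncomputable def rightMulMatrix : CrossedProduct f →+* Matrix G G A where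
  toFun x := Matrix.of fun g a => g • coeff x (g⁻¹ * a) * f.toFun g (g⁻¹ * a)
  map_zero' := by
    ext g a
    simp
  map_add' x y := by
    ext g a
    simp [add_mul]
  map_one' := by
    ext g a
    rw [one_def', Matrix.of_apply, coeff_mk_apply, Matrix.one_apply]
    by_cases h : g = a
    · subst h
      rw [inv_mul_cancel, if_pos rfl, if_pos rfl, cocycle_one_right, ← smul_mul', Units.inv_mul,
        smul_one]
    · rw [if_neg (fun h' => h (inv_mul_eq_one.mp h'.symm)), if_neg h, smul_zero, zero_mul]
  map_mul' x y := by
    induction x using induction_on with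
    | h0 => ext g a; simp [Matrix.mul_apply]
    | ha x x' hx hx' =>
      rw [add_mul]
      ext g a
      have h1 := congrFun (congrFun hx g) a
      have h2 := congrFun (congrFun hx' g) a
      simp only [Matrix.of_apply, Matrix.mul_apply, map_add, Finsupp.add_apply, smul_add,
        add_mul, Finset.sum_add_distrib] at h1 h2 ⊢
      rw [h1, h2]
    | hs h s =>
      induction y using induction_on with
      | h0 => ext g a; simp [Matrix.mul_apply]
      | ha y y' hy hy' =>
        rw [mul_add]
        ext g a
        have h1 := congrFun (congrFun hy g) a
        have h2 := congrFun (congrFun hy' g) a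
        simp only [Matrix.of_apply, Matrix.mul_apply, map_add, Finsupp.add_apply, smul_add,
          add_mul, mul_add, Finset.sum_add_distrib] at h1 h2 ⊢
        rw [h1, h2]
      | hs k t =>
        ext g b
        rw [mk_mul_mk, Matrix.mul_apply]
        simp only [Matrix.of_apply, coeff_mk_apply]
        rw [Finset.sum_eq_single (g * h)]
        · simp only [inv_mul_cancel_left, if_true]
          by_cases hb : b = g * h * k
          · subst hb
            have := f.cocycle g h k
            simp only [mul_assoc, inv_mul_cancel_left, mul_inv_rev, if_true, smul_mul',
              ← mul_smul] at this ⊢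
            linear_combination -(g • s * (g * h) • t) * this
          · rw [if_neg, if_neg] <;> [skip; (rintro rfl; exact hb (by group)); (rintro h'; exact hb (by rw [mul_assoc, h']; group))]
            simp
        · intro a _ ha
          rw [if_neg, smul_zero, zero_mul, zero_mul]
          rintro rfl
          exact ha (by group)
        · simp

theorem rightMulMatrix_apply (x : CrossedProduct f) (g a : G) :
    rightMulMatrix f x g a = g • coeff x (g⁻¹ * a) * f.toFun g (g⁻¹ * a) := rfl

theorem rightMulMatrix_injective : Function.Injective (rightMulMatrix f) := by
  intro x y h
  refine ext_coeff fun g => ?_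
  have h1 := congrFun (congrFun h 1) g
  rw [rightMulMatrix_apply, rightMulMatrix_apply, inv_one, one_mul, one_smul, one_smul] at h1
  exact (f.toFun 1 g).isUnit.mul_right_cancel h1

/-- By the cocycle identity, acting by k on the entries amounts to translating rows and columns by k
and rescaling both by f(k, ·). -/
theorem smul_rightMulMatrix (x : CrossedProduct f) (k g a : G) :
    k • rightMulMatrix f x g a * f.toFun k a =
      f.toFun k g * rightMulMatrix f x (k * g) (k * a) := by
  have h := f.cocycle k g (g⁻¹ * a)
  have e : (k * g)⁻¹ * (k * a) = g⁻¹ * a := by group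
  rw [rightMulMatrix_apply, rightMulMatrix_apply, e, smul_mul', ← mul_smul]
  rw [mul_inv_cancel_left] at h
  linear_combination -((k * g) • coeff x (g⁻¹ * a)) * h

variable (f) in
/-- The determinant of right multiplication on the free left module of rank `|G|`. -/
noncomputable def norm : CrossedProduct f →* A := 
  Matrix.detMonoidHom.comp (rightMulMatrix f).toMonoidHom

theorem norm_def (x : CrossedProduct f) : norm f x = (rightMulMatrix f x).det := rfl

/-- Rows and columns are rescaled by the same total factor, and a simultaneous permutation preserves
the determinant. -/
theorem smul_norm (x : CrossedProduct f) (k : G) : k • norm f x = norm f x := by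
  have h1 : k • norm f x = (Matrix.of fun g a => k • rightMulMatrix f x g a).det :=
    RingHom.map_det (MulSemiringAction.toRingHom G A k) _
  have h2 : ((rightMulMatrix f x).submatrix (Equiv.mulLeft k) (Equiv.mulLeft k)).det = norm f x :=
    Matrix.det_submatrix_equiv_self _ _
  have h3 := Matrix.det_mul_row (fun a => (f.toFun k a : A))
    (Matrix.of fun g a => k • rightMulMatrix f x g a)
  have h4 := Matrix.det_mul_column (fun a => (f.toFun k a : A))
    ((rightMulMatrix f x).submatrix (Equiv.mulLeft k) (Equiv.mulLeft k))
  have h5 : (Matrix.of fun i j => (f.toFun k j : A) *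
        (Matrix.of fun g a => k • rightMulMatrix f x g a) i j) =
      Matrix.of fun i j => (f.toFun k i : A) *
        ((rightMulMatrix f x).submatrix (Equiv.mulLeft k) (Equiv.mulLeft k)) i j := by
    ext i j
    simp only [Matrix.of_apply, Matrix.submatrix_apply, Equiv.coe_mulLeft]
    rw [← smul_rightMulMatrix, mul_comm]
  rw [h5, h4, h2, ← h1] at h3
  have hu : IsUnit (∏ g, (f.toFun k g : A)) := by
    rw [← Units.coe_prod]
    exact Units.isUnit _
  exact (hu.mul_left_cancel h3).symm

theorem norm_smul_one (s : A) : norm f (s • 1) = ∏ g : G, g • s := by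
  have : rightMulMatrix f (s • 1) = Matrix.diagonal fun g => g • s := by
    ext g a
    have h1 := congrFun (congrFun (map_one (rightMulMatrix f)) g) a
    rw [rightMulMatrix_apply] at h1 ⊢
    rw [coeff_smul_apply, smul_mul', mul_assoc, h1, Matrix.one_apply, Matrix.diagonal_apply]
    simp
  rw [norm_def, this, Matrix.det_diagonal]

/-- The inverse matrix need not come from the crossed product a priori, but an element is determined
by its row at 1. So `y` is built from the required row at 1, which makes it a left inverse; matrices
then make it two-sided. -/
theorem isUnit_of_isUnit_norm {x : CrossedProduct f} (hx : IsUnit (norm f x)) : IsUnit x := by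
  have hx' : IsUnit (rightMulMatrix f x).det := hx
  obtain ⟨y, hy⟩ : ∃ y : CrossedProduct f, y * x = 1 := by
    let v := Matrix.vecMul (rightMulMatrix f 1 1) (rightMulMatrix f x)⁻¹
    let y : CrossedProduct f := coeff.symm
      (Finsupp.equivFunOnFinite.symm fun a => v a * ((f.toFun 1 a)⁻¹ : Aˣ))
    have hy (a : G) : rightMulMatrix f y 1 a = v a := by
      have : coeff y a = v a * ((f.toFun 1 a)⁻¹ : Aˣ) := rfl
      rw [rightMulMatrix_apply, inv_one, one_mul, one_smul, this, Units.inv_mul_cancel_right]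
    refine ⟨y, ext_coeff fun g => ?_⟩
    have h1 : rightMulMatrix f (y * x) 1 = rightMulMatrix f 1 1 := by
      rw [map_mul, Matrix.mul_apply_eq_vecMul, funext hy, Matrix.vecMul_vecMul,
        Matrix.nonsing_inv_mul _ hx', Matrix.vecMul_one]
    have h2 := congrFun h1 g
    rw [rightMulMatrix_apply, rightMulMatrix_apply, inv_one, one_mul, one_smul, one_smul] at h2
    exact (f.toFun 1 g).isUnit.mul_right_cancel h2
  refine ⟨⟨x, y, rightMulMatrix_injective ?_, hy⟩, rfl⟩
  have h := congrArg (rightMulMatrix f) hy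
  rw [map_mul, map_one] at h ⊢
  exact mul_eq_one_comm.mp h

theorem isUnit_norm_iff {x : CrossedProduct f} : IsUnit (norm f x) ↔ IsUnit x :=
  ⟨isUnit_of_isUnit_norm, fun h => h.map (norm f)⟩

/-- `G` acts on permutations by conjugation with left translations and preserves the reduced Leibniz
terms. Only the fixed permutations survive, and their terms are |G|-th powers of single coefficients
times constants, which are additive in characteristic p. -/
theorem map_norm_add {p : ℕ} [Fact p.Prime] (hG : IsPGroup p G) {k : Type*} [CommRing k]
    [CharP k p] (φ : A →+* k) (hφ : ∀ (g : G) (a : A), φ (g • a) = φ a)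
    (x y : CrossedProduct f) : φ (norm f (x + y)) = φ (norm f x) + φ (norm f y) := by
  let _ : MulAction G (Equiv.Perm G) := MulAction.compHom (Equiv.Perm G)
    ((ConjAct.toConjAct (G := Equiv.Perm G)).toMonoidHom.comp (MulAction.toPermHom G G))
  have hsmul (g h : G) (σ : Equiv.Perm G) : (g • σ) h = g * σ (g⁻¹ * h) := rfl
  let t (z : CrossedProduct f) (σ : Equiv.Perm G) : k :=
    ((Equiv.Perm.sign σ : ℤ) : k) * ∏ i, φ (rightMulMatrix f z (σ i) i)
  classical
  have key (z : CrossedProduct f) : φ (norm f z) =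
      ∑ σ : Equiv.Perm G with σ ∈ MulAction.fixedPoints G (Equiv.Perm G), t z σ := by
    rw [← hG.sum_eq_sum_fixedPoints (t z), norm_def, RingHom.map_det, Matrix.det_apply']
    · rfl
    intro g σ
    have h1 : Equiv.Perm.sign (g • σ) = Equiv.Perm.sign σ := by
      change Equiv.Perm.sign (MulAction.toPermHom G G g * σ * (MulAction.toPermHom G G g)⁻¹) = _
      rw [map_mul, map_mul, mul_right_comm, map_inv, mul_inv_cancel, one_mul]
    have h2 : ∏ i, φ (rightMulMatrix f z ((g • σ) i) i) =
        ∏ i, φ (rightMulMatrix f z (g * σ i) (g * i)) := by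
      rw [← Equiv.prod_comp (Equiv.mulLeft g)]
      refine Finset.prod_congr rfl fun i _ => ?_
      rw [Equiv.coe_mulLeft, hsmul, inv_mul_cancel_left]
    have h3 : (∏ i, φ (f.toFun g (σ i))) * ∏ i, φ (rightMulMatrix f z (g * σ i) (g * i)) =
        (∏ i, φ (f.toFun g i)) * ∏ i, φ (rightMulMatrix f z (σ i) i) := by
      rw [← Finset.prod_mul_distrib, ← Finset.prod_mul_distrib]
      refine Finset.prod_congr rfl fun i _ => ?_
      rw [← map_mul, ← smul_rightMulMatrix, map_mul, hφ, mul_comm]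
    rw [Equiv.prod_comp σ fun i => φ (f.toFun g i)] at h3
    have hu : IsUnit (∏ i, φ (f.toFun g i : A)) := by
      rw [← map_prod, ← Units.coe_prod]
      exact (Units.isUnit _).map φ
    change _ * _ = _ * _
    rw [h1, h2, hu.mul_left_cancel h3]
  rw [key, key, key, ← Finset.sum_add_distrib]
  refine Finset.sum_congr rfl fun σ hσ => ?_
  -- A permutation commuting with all left translations is a right translation.
  have hσ' (i : G) : (σ i)⁻¹ * i = (σ 1)⁻¹ := by
    have h1 := congrArg (fun τ : Equiv.Perm G => τ i) ((Finset.mem_filter.mp hσ).2 i)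
    simp only [hsmul, inv_mul_cancel] at h1
    rw [← h1]
    group
  have hprod (z : CrossedProduct f) : ∏ i, φ (rightMulMatrix f z (σ i) i) =
      φ (coeff z (σ 1)⁻¹) ^ Nat.card G * ∏ i, φ (f.toFun (σ i) (σ 1)⁻¹) := by
    rw [Nat.card_eq_fintype_card, ← Finset.card_univ, ← Finset.prod_const,
      ← Finset.prod_mul_distrib]
    refine Finset.prod_congr rfl fun i _ => ?_
    rw [rightMulMatrix_apply, hσ', map_mul, hφ]
  obtain ⟨n, hn⟩ := IsPGroup.iff_card.mp hG
  simp only [t, hprod]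
  rw [map_add, Finsupp.add_apply, map_add, hn, add_pow_char_pow]
  ring

end Norm

end CrossedProduct

/-! ### The local ring S^f * H for a p-group H. -/

namespace CrossedProduct

section DVR

variable {H S : Type*} [CommRing S] [IsDomain S] [IsDiscreteValuationRing S]
  [Group H] [MulSemiringAction H S] {f : TwoCocycle H S}

/-- The underlying free `S`-module of the crossed product. -/
noncomputable def linearEquivFun [Finite H] : CrossedProduct f ≃ₗ[S] (H → S) :=
  Finsupp.linearEquivFunOnFinite S S H

instance isNoetherian_of_finite [Finite H] : IsNoetherian S (CrossedProduct f) :=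
  isNoetherian_of_linearEquiv (linearEquivFun (f := f)).symm

instance isNoetherianRing_of_finite [Finite H] : IsNoetherianRing (CrossedProduct f) :=
  isNoetherian_of_tower S inferInstance

/-- Each gπ is a unit times π, so π normalizes the crossed product; the next lemma is the opposite
inclusion. -/
theorem exists_mul_smul_one_eq {π : S} (hπ : Irreducible π) (x : CrossedProduct f) :
    ∃ y, π • x = y * (π • 1) := by
  induction x using induction_on with
  | h0 => exact ⟨0, by simp⟩
  | ha x x' hx hx' =>
    obtain ⟨y, hy⟩ := hx
    obtain ⟨y', hy'⟩ := hx'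
    exact ⟨y + y', by rw [smul_add, hy, hy', add_mul]⟩
  | hs g s =>
    obtain ⟨u, hu⟩ := exists_smul_eq_mul_irreducible hπ g
    refine ⟨mk f g (s * ((u⁻¹ : Sˣ) : S)), ?_⟩
    rw [mk_mul_smul, mul_one, hu, smul_mk, smul_mk, smul_eq_mul, smul_eq_mul]
    congr 1
    linear_combination -(π * s) * u.mul_inv

theorem exists_smul_eq_mul_smul_one {π : S} (hπ : Irreducible π) (x : CrossedProduct f) :
    ∃ y, x * (π • 1) = π • y := by
  induction x using induction_on with
  | h0 => exact ⟨0, by simp⟩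
  | ha x x' hx hx' =>
    obtain ⟨y, hy⟩ := hx
    obtain ⟨y', hy'⟩ := hx'
    exact ⟨y + y', by rw [smul_add, ← hy, ← hy', add_mul]⟩
  | hs g s =>
    obtain ⟨u, hu⟩ := exists_smul_eq_mul_irreducible hπ g
    refine ⟨mk f g (u * s), ?_⟩
    rw [mk_mul_smul, mul_one, hu, smul_mk, smul_mk, smul_eq_mul, smul_eq_mul]
    congr 1
    ring

end DVR

section PGroup

variable {H S : Type*} [CommRing S] [IsDomain S] [IsDiscreteValuationRing S]
  [Group H] [Fintype H] [DecidableEq H] [MulSemiringAction H S]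
  {p : ℕ} [Fact p.Prime] [CharP (ResidueField S) p]
  (f : TwoCocycle H S) (hH : IsPGroup p H)
  (htriv : ∀ (h : H) (s : S), h • s - s ∈ maximalIdeal S)

/-- If a finite `p`-group `H` acts trivially on the residue field of `S`, of characteristic `p`,
the norm `S^f * H → S` is additive modulo the maximal ideal. -/
noncomputable def residueNorm : CrossedProduct f →+* ResidueField S where
  toFun x := residue S (norm f x)
  map_one' := by rw [map_one, map_one]
  map_mul' x y := by rw [map_mul, map_mul]
  map_zero' := by
    have h := map_norm_add hH (residue S) (fun g a => Ideal.Quotient.eq.mpr (htriv g a))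
      (0 : CrossedProduct f) 0
    rwa [add_zero, left_eq_add] at h
  map_add' x y := map_norm_add hH (residue S) (fun g a => Ideal.Quotient.eq.mpr (htriv g a)) x y

theorem residueNorm_apply (x : CrossedProduct f) :
    residueNorm f hH htriv x = residue S (norm f x) := rfl

/-- The ideal of nonunits of `S^f * H`. -/
noncomputable def nonunitsIdeal : Ideal (CrossedProduct f) := RingHom.ker (residueNorm f hH htriv)

instance : (nonunitsIdeal f hH htriv).IsTwoSided :=
  inferInstanceAs (RingHom.ker (residueNorm f hH htriv)).IsTwoSided

variable {f}

theorem mem_nonunitsIdeal_iff_norm {x : CrossedProduct f} :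
    x ∈ nonunitsIdeal f hH htriv ↔ norm f x ∈ maximalIdeal S := by
  rw [nonunitsIdeal, RingHom.mem_ker, residueNorm_apply, residue_eq_zero_iff]

theorem mem_nonunitsIdeal {x : CrossedProduct f} :
    x ∈ nonunitsIdeal f hH htriv ↔ ¬ IsUnit x := by
  rw [mem_nonunitsIdeal_iff_norm, mem_maximalIdeal, mem_nonunits_iff, isUnit_norm_iff]

theorem residueNorm_smul_one (s : S) :
    residueNorm f hH htriv (s • 1) = residue S s ^ Nat.card H := by
  rw [residueNorm_apply, norm_smul_one, map_prod, Finset.prod_congr rfl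
    (g := fun _ => residue S s) fun h _ => ?_, Finset.prod_const,
    Finset.card_univ, Nat.card_eq_fintype_card]
  exact Ideal.Quotient.eq.mpr (htriv h s)

theorem smul_one_mem_nonunitsIdeal {a : S} (ha : a ∈ maximalIdeal S) :
    a • (1 : CrossedProduct f) ∈ nonunitsIdeal f hH htriv := by
  have h : residueNorm f hH htriv (a • 1) = 0 := by
    rw [residueNorm_smul_one, (residue_eq_zero_iff a).mpr ha, zero_pow Nat.card_pos.ne']
  exact h

theorem smul_mem_nonunitsIdeal {a : S} (ha : a ∈ maximalIdeal S) (x : CrossedProduct f) :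
    a • x ∈ nonunitsIdeal f hH htriv := by
  rw [← one_mul x, ← smul_mul]
  exact Ideal.mul_mem_right _ _ (smul_one_mem_nonunitsIdeal hH htriv ha)

/-- A proper left ideal consists of nonunits, so the nonunits form the only maximal left ideal. -/
theorem nonunitsIdeal_le_jacobson :
    nonunitsIdeal f hH htriv ≤ Ring.jacobson (CrossedProduct f) := by
  rw [Ring.jacobson_eq_sInf_isMaximal]
  refine le_sInf fun m hm => ?_
  have h1 : m ≤ nonunitsIdeal f hH htriv := fun x hx =>
    (mem_nonunitsIdeal hH htriv).mpr fun hu => hm.ne_top (Ideal.eq_top_of_isUnit_mem _ hx hu)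
  refine (hm.eq_of_le (fun h => ?_) h1).ge
  have h2 : (1 : CrossedProduct f) ∈ nonunitsIdeal f hH htriv := h ▸ Submodule.mem_top
  exact (mem_nonunitsIdeal hH htriv).mp h2 isUnit_one

theorem not_nonunitsIdeal_le_smul_self :
    ¬ nonunitsIdeal f hH htriv ≤ nonunitsIdeal f hH htriv • nonunitsIdeal f hH htriv := by
  intro h
  have h1 : nonunitsIdeal f hH htriv = ⊥ :=
    Submodule.FG.eq_bot_of_le_jacobson_smul (IsNoetherian.noetherian _)
      (h.trans (Submodule.smul_mono_left (nonunitsIdeal_le_jacobson hH htriv)))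
  obtain ⟨π, hπ⟩ := IsDiscreteValuationRing.exists_irreducible S
  have h2 : π • (1 : CrossedProduct f) ∈ nonunitsIdeal f hH htriv :=
    smul_one_mem_nonunitsIdeal hH htriv ((mem_maximalIdeal_iff_dvd hπ _).mpr dvd_rfl)
  rw [h1, Ideal.mem_bot] at h2
  have h3 := congrArg (norm f) h2
  rw [norm_smul_one] at h3
  have h4 : norm f 0 = 0 := by rw [norm_def, map_zero, Matrix.det_zero]
  rw [h4, Finset.prod_eq_zero_iff] at h3
  obtain ⟨g, -, hg⟩ := h3
  exact hπ.ne_zero ((smul_eq_zero_iff_eq g).mp hg)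

/-- J is nilpotent modulo `a`, and t is taken in the last power of J not contained in the multiples
of `a`. Then t/a is not integral although J(t/a) is. -/
theorem exists_mul_mem_smul_of_not_mem {a : S} (ha : ∀ h : H, h • a = a) (ha0 : a ≠ 0)
    (haM : a ∈ maximalIdeal S) :
    ∃ t : CrossedProduct f, (¬ ∃ w, t = a • w) ∧
      ∀ j ∈ nonunitsIdeal f hH htriv, ∃ w, j * t = a • w := by
  let J := nonunitsIdeal f hH htriv
  let A : Ideal (CrossedProduct f) :=
    { carrier := {t | ∃ w, t = a • w}
      add_mem' := by
        rintro _ _ ⟨w, rfl⟩ ⟨w', rfl⟩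
        exact ⟨w + w', (smul_add _ _ _).symm⟩
      zero_mem' := ⟨0, (smul_zero a).symm⟩
      smul_mem' := by
        rintro x _ ⟨w, rfl⟩
        exact ⟨x * w, mul_smul_of_invariant ha x w⟩ }
  let N : ℕ → Ideal (CrossedProduct f) := fun n => n.rec ⊤ fun _ I => J • I
  have hN0 : N 0 = ⊤ := rfl
  have hN1 (n : ℕ) : N (n + 1) = J • N n := rfl
  have hanti : Antitone N := antitone_nat_of_succ_le fun n => by
    rw [hN1]
    exact Submodule.smul_le_right
  -- the quotient by `a` has finite length over `S`
  let ψ : CrossedProduct f →ₗ[S] (H → S ⧸ Ideal.span {a}) :=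
    (LinearMap.compLeft (Submodule.mkQ (Ideal.span {a})) H).comp linearEquivFun.toLinearMap
  have hψ (x : CrossedProduct f) : ψ x = 0 ↔ x ∈ A := by
    constructor
    · intro h
      have h1 (g : H) : a ∣ coeff x g := by
        rw [← Ideal.mem_span_singleton, ← Submodule.Quotient.mk_eq_zero]
        exact congrFun h g
      choose c hc using h1
      exact ⟨linearEquivFun.symm c, ext_coeff hc⟩
    · rintro ⟨w, rfl⟩
      funext g
      exact (Submodule.Quotient.mk_eq_zero _).mpr
        (Ideal.mem_span_singleton.mpr ⟨coeff w g, rfl⟩)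
  have hart : IsArtinian S (H → S ⧸ Ideal.span {a}) := by
    have h1 := isFiniteLength_quotient_span_singleton S (mem_nonZeroDivisors_of_ne_zero ha0)
    have h2 := (isFiniteLength_iff_isNoetherian_isArtinian.mp h1).2
    infer_instance
  -- The powers of J stabilize modulo `a` by finite length; Nakayama makes the stable value zero.
  have hex : ∃ n, N n ≤ A := by
    obtain ⟨n, hn⟩ := IsArtinian.monotone_stabilizes
      (⟨fun n => OrderDual.toDual (((N n).restrictScalars S).map ψ), fun i j hij =>
        Submodule.map_mono (hanti hij)⟩ : ℕ →o (Submodule S (H → S ⧸ Ideal.span {a}))ᵒᵈ)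
    have h1 : ((N n).restrictScalars S).map ψ = ((N (n + 1)).restrictScalars S).map ψ :=
      hn (n + 1) n.le_succ
    refine ⟨n, ?_⟩
    have h2 : Submodule.map A.mkQ (N n) ≤ Ring.jacobson (CrossedProduct f) •
        Submodule.map A.mkQ (N n) := by
      refine le_trans ?_ (Submodule.smul_mono_left (nonunitsIdeal_le_jacobson hH htriv))
      rw [← Submodule.map_smul'', ← hN1]
      rintro _ ⟨x, hx, rfl⟩
      obtain ⟨y, hy, hxy⟩ : ψ x ∈ ((N (n + 1)).restrictScalars S).map ψ := h1 ▸ ⟨x, hx, rfl⟩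
      refine ⟨y, hy, ?_⟩
      rw [Submodule.mkQ_apply, Submodule.mkQ_apply, Submodule.Quotient.eq, ← hψ, map_sub, hxy,
        sub_self]
    have h3 := Submodule.FG.eq_bot_of_le_jacobson_smul
      ((IsNoetherian.noetherian (N n)).map A.mkQ) h2
    intro x hx
    have h4 : A.mkQ x ∈ Submodule.map A.mkQ (N n) := ⟨x, hx, rfl⟩
    rwa [h3, Submodule.mem_bot, Submodule.mkQ_apply, Submodule.Quotient.mk_eq_zero] at h4
  obtain ⟨m, hfind, hmin⟩ : ∃ m, N m ≤ A ∧ ∀ k < m, ¬ N k ≤ A := by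
    classical
    exact ⟨Nat.find hex, Nat.find_spec hex, fun k hk => Nat.find_min hex hk⟩
  have hm0 : m ≠ 0 := by
    intro h0
    rw [h0, hN0] at hfind
    obtain ⟨w, hw⟩ : (1 : CrossedProduct f) ∈ A := hfind Submodule.mem_top
    have h1 := smul_mem_nonunitsIdeal hH htriv haM w
    rw [← hw, mem_nonunitsIdeal] at h1
    exact h1 isUnit_one
  obtain ⟨m', hm'⟩ := Nat.exists_eq_succ_of_ne_zero hm0
  have h1 : ¬ N m' ≤ A := hmin m' (by omega)
  obtain ⟨t, ht, htA⟩ := SetLike.not_le_iff_exists.mp h1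
  refine ⟨t, htA, fun j hj => ?_⟩
  have h2 : j * t ∈ N m := by
    rw [hm', hN1]
    exact Submodule.smul_mem_smul hj ht
  exact hfind h2

/-- A uniformizer of `S` is irreducible in `S^f * H`. -/
theorem isUnit_of_mul_eq_smul_one [FaithfulSMul H S]
    (hres : ∀ s : S, ∃ r : S, (∀ h : H, h • r = r) ∧ s - r ∈ maximalIdeal S)
    {π : S} (hπ : Irreducible π) {x y : CrossedProduct f}
    (hx : x ∈ nonunitsIdeal f hH htriv) (hxy : x * y = π • 1) : IsUnit y := by
  by_contra hy
  rw [← mem_nonunitsIdeal hH htriv, mem_nonunitsIdeal_iff_norm] at hy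
  rw [mem_nonunitsIdeal_iff_norm] at hx
  have h1 := pow_card_dvd_of_invariant hres hπ (smul_norm x) hx
  have h2 := pow_card_dvd_of_invariant hres hπ (smul_norm y) hy
  have h3 : norm f x * norm f y = ∏ g : H, g • π := by rw [← map_mul, hxy, norm_smul_one]
  choose u hu using fun g : H => exists_smul_eq_mul_irreducible hπ g
  have h4 : ∏ g : H, g • π = ((∏ g, u g : Sˣ) : S) * π ^ Nat.card H := by
    rw [Finset.prod_congr rfl fun g _ => hu g, Finset.prod_mul_distrib, Finset.prod_const,
      Finset.card_univ, Nat.card_eq_fintype_card, Units.coe_prod]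
  have h5 := mul_dvd_mul h1 h2
  rw [h3, h4, (Units.isUnit _).dvd_mul_left, ← pow_add,
    pow_dvd_pow_iff hπ.ne_zero hπ.not_isUnit] at h5
  have : 0 < Nat.card H := Nat.card_pos
  omega

/-- If the ideal of nonunits `J` of `S^f * H` admits a linear form whose values are not all in `J`,
then `J` is generated by any uniformizer of `S`. -/
theorem exists_eq_smul_of_linearMap [FaithfulSMul H S]
    (hres : ∀ s : S, ∃ r : S, (∀ h : H, h • r = r) ∧ s - r ∈ maximalIdeal S)
    {π : S} (hπ : Irreducible π)
    (φ : nonunitsIdeal f hH htriv →ₗ[CrossedProduct f] CrossedProduct f)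
    (y : nonunitsIdeal f hH htriv) (hy : φ y ∉ nonunitsIdeal f hH htriv)
    {z : CrossedProduct f} (hz : z ∈ nonunitsIdeal f hH htriv) : ∃ w, z = π • w := by
  have hπJ : π • (1 : CrossedProduct f) ∈ nonunitsIdeal f hH htriv :=
    smul_one_mem_nonunitsIdeal hH htriv ((mem_maximalIdeal_iff_dvd hπ _).mpr dvd_rfl)
  rw [mem_nonunitsIdeal, not_not] at hy
  obtain ⟨u, hu⟩ := hy
  have hinj : Function.Injective fun w : CrossedProduct f => π • w := by
    intro w w' h
    refine ext_coeff fun g => mul_left_cancel₀ hπ.ne_zero ?_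
    exact congrArg (fun x => coeff x g) h
  -- Apply φ to πx = x'π, whose two sides are multiples of elements of J.
  have key (x : nonunitsIdeal f hH htriv) {x' : CrossedProduct f}
      (hx' : π • (x : CrossedProduct f) = x' * (π • 1)) :
      π • φ x = x' * φ ⟨π • 1, hπJ⟩ := by
    have e : (π • (1 : CrossedProduct f)) • x = x' • (⟨π • 1, hπJ⟩ : nonunitsIdeal f hH htriv) := by
      refine Subtype.ext ?_
      simp only [Submodule.coe_smul, smul_eq_mul, smul_mul, one_mul]
      exact hx'
    have h := congrArg φ e
    rw [map_smul, map_smul, smul_eq_mul, smul_eq_mul, smul_mul, one_mul] at h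
    exact h
  obtain ⟨t, ht⟩ : IsUnit (φ ⟨π • 1, hπJ⟩) := by
    -- φ(u⁻¹y) = 1, so `key` factors π as x' φ(π). Cancelling the norm of π shows that x' has the
    -- same norm as u⁻¹y, a nonunit; irreducibility then makes φ(π) a unit.
    obtain ⟨x', hx'⟩ := exists_mul_smul_one_eq hπ
      (((u⁻¹ : (CrossedProduct f)ˣ) : CrossedProduct f) * (y : CrossedProduct f))
    refine isUnit_of_mul_eq_smul_one hH htriv hres hπ (x := x') ?_ ?_
    · have h1 : (((u⁻¹ : (CrossedProduct f)ˣ) : CrossedProduct f) * (y : CrossedProduct f)) ∈ nonunitsIdeal f hH htriv :=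
        Ideal.mul_mem_left _ _ y.2
      rw [mem_nonunitsIdeal_iff_norm] at h1 ⊢
      have h2 := congrArg (norm f) hx'
      rw [← one_mul (_ * (y : CrossedProduct f)), ← smul_mul, map_mul, map_mul _ x',
        mul_comm (norm f x')] at h2
      have h3 : norm f (π • 1) ≠ 0 := by
        rw [norm_smul_one, Finset.prod_ne_zero_iff]
        exact fun g _ h => hπ.ne_zero ((smul_eq_zero_iff_eq g).mp h)
      rwa [← mul_left_cancel₀ h3 h2]
    · rw [← key (((u⁻¹ : (CrossedProduct f)ˣ) : CrossedProduct f) • y) hx', map_smul, ← hu,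
        smul_eq_mul, Units.inv_mul]
  obtain ⟨z', hz'⟩ := exists_mul_smul_one_eq hπ z
  have h1 := key ⟨z, hz⟩ hz'
  rw [← ht] at h1
  -- Substituting this in πz = z'π and cancelling π on the left puts z in the left ideal generated
  -- by π.
  have h2 : z' = π • (φ ⟨z, hz⟩ * ((t⁻¹ : (CrossedProduct f)ˣ) : CrossedProduct f)) := by
    rw [← smul_mul, h1, Units.mul_inv_cancel_right]
  rw [h2, smul_mul] at hz'
  obtain ⟨w, hw⟩ := exists_smul_eq_mul_smul_one hπ
    (φ ⟨z, hz⟩ * ((t⁻¹ : (CrossedProduct f)ˣ) : CrossedProduct f))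
  exact ⟨w, (hinj hz').trans hw⟩

end PGroup

end CrossedProduct

/-! ### Crossed products of normal subgroups and extension of ideals. -/

/-- The restriction of a 2-cocycle to a subgroup. -/
def TwoCocycle.restrict {G A : Type*} [Group G] [CommRing A] [MulSemiringAction G A]
    (f : TwoCocycle G A) (P : Subgroup G) : TwoCocycle P A where
  toFun g h := f.toFun g h
  cocycle g h k := f.cocycle g h k

namespace CrossedProduct

section Subgroup

variable {G A : Type*} [Group G] [CommRing A] [MulSemiringAction G A] (f : TwoCocycle G A)
  (P : Subgroup G)

/-- The inclusion `A^f * P → A^f * G` for a subgroup `P` of `G`. -/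
noncomputable def inclusion : CrossedProduct (f.restrict P) →+* CrossedProduct f :=
  { Finsupp.mapDomain.addMonoidHom (M := A) (Subtype.val : P → G) with
    map_one' := Finsupp.mapDomain_single
    map_mul' := by
      intro x y
      let i : CrossedProduct (f.restrict P) →+ CrossedProduct f :=
        Finsupp.mapDomain.addMonoidHom (M := A) (Subtype.val : P → G)
      have hi (g : P) (s : A) : i (mk (f.restrict P) g s) = mk f g s := Finsupp.mapDomain_single
      change i (x * y) = i x * i y
      induction x using induction_on with
      | h0 => simp
      | ha x x' hx hx' => rw [add_mul, map_add, map_add, add_mul, hx, hx']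
      | hs g s =>
        induction y using induction_on with
        | h0 => simp
        | ha y y' hy hy' => rw [mul_add, map_add, map_add, mul_add, hy, hy']
        | hs h t =>
          rw [mk_mul_mk, hi, hi, hi, mk_mul_mk]
          rfl }

theorem inclusion_mk (g : P) (s : A) : inclusion f P (mk (f.restrict P) g s) = mk f g s :=
  Finsupp.mapDomain_single

theorem inclusion_smul (s : A) (x : CrossedProduct (f.restrict P)) :
    inclusion f P (s • x) = s • inclusion f P x := by
  induction x using induction_on with
  | h0 => simp
  | ha x x' hx hx' => rw [smul_add, map_add, map_add, smul_add, hx, hx']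
  | hs g t => rw [smul_mk, inclusion_mk, inclusion_mk, smul_mk]

theorem inclusion_injective : Function.Injective (inclusion f P) :=
  Finsupp.mapDomain_injective Subtype.val_injective

variable {f} in
theorem isUnit_mk_one (g : G) : IsUnit (mk f g 1) := by
  refine isUnit_iff_exists_and_exists.mpr
    ⟨⟨mk f g⁻¹ (g⁻¹ • (((f.toFun 1 1)⁻¹ : Aˣ) * ((f.toFun g g⁻¹)⁻¹ : Aˣ))), ?_⟩,
      ⟨mk f g⁻¹ (((f.toFun 1 1)⁻¹ : Aˣ) * ((f.toFun g⁻¹ g)⁻¹ : Aˣ)), ?_⟩⟩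
  · rw [mk_mul_mk, smul_inv_smul, one_mul, Units.inv_mul_cancel_right, mul_inv_cancel, one_def']
  · rw [mk_mul_mk, smul_one, mul_one, Units.inv_mul_cancel_right, inv_mul_cancel, one_def']

theorem exists_mk_one_mul_inclusion [P.Normal] (g : G) (x : CrossedProduct (f.restrict P)) :
    ∃ y, mk f g 1 * inclusion f P x = inclusion f P y * mk f g 1 := by
  induction x using induction_on with
  | h0 => exact ⟨0, by simp⟩
  | ha x x' hx hx' =>
    obtain ⟨y, hy⟩ := hx
    obtain ⟨y', hy'⟩ := hx'
    exact ⟨y + y', by rw [map_add, mul_add, hy, hy', map_add, add_mul]⟩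
  | hs h s =>
    refine ⟨mk _ ⟨g * h * g⁻¹, ‹P.Normal›.conj_mem h h.2 g⟩
      (g • s * f.toFun g h * ((f.toFun (g * h * g⁻¹) g)⁻¹ : Aˣ)), ?_⟩
    rw [inclusion_mk, inclusion_mk, mk_mul_mk, mk_mul_mk, inv_mul_cancel_right, smul_one, mul_one,
      Units.inv_mul_cancel_right, one_mul]

theorem exists_inclusion_mul_mk_one [P.Normal] (g : G) (y : CrossedProduct (f.restrict P)) :
    ∃ x, mk f g 1 * inclusion f P x = inclusion f P y * mk f g 1 := by
  induction y using induction_on with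
  | h0 => exact ⟨0, by simp⟩
  | ha x x' hx hx' =>
    obtain ⟨y, hy⟩ := hx
    obtain ⟨y', hy'⟩ := hx'
    exact ⟨y + y', by rw [map_add, mul_add, hy, hy', map_add, add_mul]⟩
  | hs h s =>
    have hmem : g⁻¹ * h * g ∈ P := by
      simpa using ‹P.Normal›.conj_mem h h.2 g⁻¹
    refine ⟨mk _ ⟨g⁻¹ * h * g, hmem⟩
      (g⁻¹ • (s * f.toFun h g * ((f.toFun g (g⁻¹ * h * g))⁻¹ : Aˣ))), ?_⟩
    rw [inclusion_mk, inclusion_mk, mk_mul_mk, mk_mul_mk, smul_inv_smul, one_mul,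
      Units.inv_mul_cancel_right, smul_one, mul_one, ← mul_assoc, ← mul_assoc, mul_inv_cancel,
      one_mul]

variable {f P} in
-- The relation U_g x = y U_g is the graph of conjugation by U_g: it is multiplicative and matches 1
-- with 1, so inverses correspond.
theorem isUnit_iff_of_mk_one_mul_inclusion [P.Normal] {g : G} {x y : CrossedProduct (f.restrict P)}
    (h : mk f g 1 * inclusion f P x = inclusion f P y * mk f g 1) : IsUnit x ↔ IsUnit y := by
  have hmul {x y x' y' : CrossedProduct (f.restrict P)}
      (h : mk f g 1 * inclusion f P x = inclusion f P y * mk f g 1)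
      (h' : mk f g 1 * inclusion f P x' = inclusion f P y' * mk f g 1) :
      mk f g 1 * inclusion f P (x * x') = inclusion f P (y * y') * mk f g 1 := by
    rw [map_mul, ← mul_assoc, h, mul_assoc, h', ← mul_assoc, map_mul]
  have hone {x y : CrossedProduct (f.restrict P)}
      (h : mk f g 1 * inclusion f P x = inclusion f P y * mk f g 1) : x = 1 ↔ y = 1 := by
    constructor
    · rintro rfl
      rw [map_one (inclusion f P), mul_one] at h
      refine inclusion_injective f P ((isUnit_mk_one g).mul_right_cancel ?_)
      rw [← h, map_one (inclusion f P), one_mul]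
    · rintro rfl
      rw [map_one (inclusion f P), one_mul] at h
      refine inclusion_injective f P ((isUnit_mk_one g).mul_left_cancel ?_)
      rw [h, map_one (inclusion f P), mul_one]
  rw [isUnit_iff_exists, isUnit_iff_exists]
  constructor
  · rintro ⟨b, h1, h2⟩
    obtain ⟨b', hb⟩ := exists_mk_one_mul_inclusion f P g b
    exact ⟨b', (hone (hmul h hb)).mp h1, (hone (hmul hb h)).mp h2⟩
  · rintro ⟨b', h1, h2⟩
    obtain ⟨b, hb⟩ := exists_inclusion_mul_mk_one f P g b'
    exact ⟨b, (hone (hmul h hb)).mpr h1, (hone (hmul hb h)).mpr h2⟩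

variable [Finite G]

/-- The coefficient at `U_g` of an element of `A^f * G = ∑_g (A^f * P) U_g`. -/
noncomputable def proj (g : G) : CrossedProduct f →+ CrossedProduct (f.restrict P) where
  toFun x := coeff.symm (Finsupp.equivFunOnFinite.symm fun h : P =>
    coeff x (h * g) * ((f.toFun h g)⁻¹ : Aˣ))
  map_zero' := ext_coeff fun _ => zero_mul _
  map_add' _ _ := ext_coeff fun _ => add_mul _ _ _

theorem coeff_proj (g : G) (x : CrossedProduct f) (h : P) :
    coeff (proj f P g x) h = coeff x (h * g) * ((f.toFun h g)⁻¹ : Aˣ) := rfl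

theorem proj_smul (g : G) (s : A) (x : CrossedProduct f) :
    proj f P g (s • x) = s • proj f P g x :=
  ext_coeff fun _ => mul_assoc _ _ _

theorem proj_mk_of_mem {g k : G} (h : k * g⁻¹ ∈ P) (s : A) :
    proj f P g (mk f k s) =
      mk (f.restrict P) ⟨k * g⁻¹, h⟩ (s * ((f.toFun (k * g⁻¹) g)⁻¹ : Aˣ)) := by
  classical
  refine ext_coeff fun l => ?_
  rw [coeff_proj, coeff_mk_apply, coeff_mk_apply]
  by_cases hl : k = l * g
  · subst hl
    rw [if_pos rfl, if_pos (Subtype.ext (mul_inv_cancel_right _ _)), mul_inv_cancel_right]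
  · rw [if_neg hl, if_neg fun h' => hl (mul_inv_eq_iff_eq_mul.mp (congrArg Subtype.val h')),
      zero_mul]

theorem proj_mk_of_not_mem {g k : G} (h : k * g⁻¹ ∉ P) (s : A) : proj f P g (mk f k s) = 0 := by
  classical
  refine ext_coeff fun l => ?_
  rw [coeff_proj, coeff_mk_apply, if_neg, zero_mul]
  · rfl
  · rintro rfl
    rw [mul_inv_cancel_right] at h
    exact h l.2

theorem proj_inclusion_mul (g : G) (a : CrossedProduct (f.restrict P)) (x : CrossedProduct f) :
    proj f P g (inclusion f P a * x) = a * proj f P g x := by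
  induction a using induction_on with
  | h0 => simp
  | ha a a' h h' => rw [map_add, add_mul, map_add, add_mul, h, h']
  | hs h s =>
    induction x using induction_on with
    | h0 => simp
    | ha x x' hx hx' => rw [mul_add, map_add, map_add, mul_add, hx, hx']
    | hs k t =>
      rw [inclusion_mk, mk_mul_mk]
      by_cases hk : k * g⁻¹ ∈ P
      · have hk' : h * k * g⁻¹ ∈ P := by
          rw [mul_assoc]
          exact P.mul_mem h.2 hk
        rw [proj_mk_of_mem _ _ hk, proj_mk_of_mem _ _ hk', mk_mul_mk]
        have e : (⟨h * k * g⁻¹, hk'⟩ : P) = h * ⟨k * g⁻¹, hk⟩ := Subtype.ext (mul_assoc _ _ _)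
        rw [e]
        congr 1
        have hc := f.cocycle h (k * g⁻¹) g
        rw [inv_mul_cancel_right, ← mul_assoc] at hc
        have hinv : (h : G) • (f.toFun (k * g⁻¹) g : A) *
            (h : G) • (((f.toFun (k * g⁻¹) g)⁻¹ : Aˣ) : A) = 1 := by
          rw [← smul_mul', Units.mul_inv, smul_one]
        have h1 : ((h : G) • (((f.toFun (k * g⁻¹) g)⁻¹ : Aˣ) : A)) * f.toFun h (k * g⁻¹) =
            f.toFun h k * ((f.toFun (h * k * g⁻¹) g)⁻¹ : Aˣ) := by
          rw [Units.eq_mul_inv_iff_mul_eq]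
          linear_combination ((h : G) • (((f.toFun (k * g⁻¹) g)⁻¹ : Aˣ) : A)) * hc +
            (f.toFun h k : A) * hinv
        change _ = s * (h : G) • (t * _) * f.toFun h (k * g⁻¹)
        rw [smul_mul']
        linear_combination -(s * (h : G) • t) * h1
      · have hk' : h * k * g⁻¹ ∉ P := by
          rw [mul_assoc]
          exact fun h' => hk ((P.mul_mem_cancel_left h.2).mp h')
        rw [proj_mk_of_not_mem _ _ hk, proj_mk_of_not_mem _ _ hk', mul_zero]

theorem proj_inclusion_mul_mk_one (g : G) (a : CrossedProduct (f.restrict P)) :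
    proj f P g (inclusion f P a * mk f g 1) = a := by
  have hmem : g * g⁻¹ ∈ P := by
    rw [mul_inv_cancel]
    exact P.one_mem
  rw [proj_inclusion_mul, proj_mk_of_mem _ _ hmem]
  have : mk (f.restrict P) ⟨g * g⁻¹, hmem⟩ ((1 : A) * ((f.toFun (g * g⁻¹) g)⁻¹ : Aˣ)) = 1 := by
    have e : (⟨g * g⁻¹, hmem⟩ : P) = 1 := Subtype.ext (mul_inv_cancel g)
    rw [one_def', e, one_mul, mul_inv_cancel, Units.ext (cocycle_one_left f g)]
    rfl
  rw [this, mul_one]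

/-- The U_g for representatives g of the cosets Pg generate A^f * G as a left A^f * P-module. -/
theorem sum_inclusion_proj_mul_mk_one (x : CrossedProduct f) :
    x = ∑ᶠ c : Quotient (QuotientGroup.rightRel P),
      inclusion f P (proj f P c.out x) * mk f c.out 1 := by
  classical
  have := Fintype.ofFinite (Quotient (QuotientGroup.rightRel P))
  rw [finsum_eq_sum_of_fintype]
  induction x using induction_on with
  | h0 => simp
  | ha x y hx hy =>
    conv_lhs => rw [hx, hy]
    simp only [map_add, add_mul, Finset.sum_add_distrib]
  | hs k s =>
    have hrel (c : Quotient (QuotientGroup.rightRel P)) : k * c.out⁻¹ ∈ P ↔ c = Quotient.mk _ k := by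
      rw [← QuotientGroup.rightRel_apply, ← Quotient.eq, Quotient.out_eq]
    have hmem := (hrel (Quotient.mk _ k)).mpr rfl
    rw [Finset.sum_eq_single (Quotient.mk (QuotientGroup.rightRel P) k)]
    · rw [proj_mk_of_mem _ _ hmem, inclusion_mk, mk_mul_mk, smul_one, mul_one,
        Units.inv_mul_cancel_right, inv_mul_cancel_right]
    · intro c _ hc
      rw [proj_mk_of_not_mem _ _ ((hrel c).not.mpr hc), map_zero, zero_mul]
    · simp

variable {P}

theorem proj_mul_inclusion_mul_mem [P.Normal] (J : Ideal (CrossedProduct (f.restrict P)))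
    [J.IsTwoSided]
    (hJ : ∀ (g : G) (x y : CrossedProduct (f.restrict P)),
      mk f g 1 * inclusion f P x = inclusion f P y * mk f g 1 → (x ∈ J ↔ y ∈ J))
    (x y : CrossedProduct f) {a : CrossedProduct (f.restrict P)} (ha : a ∈ J) (g : G) :
    proj f P g (x * inclusion f P a * y) ∈ J := by
  induction x using induction_on with
  | h0 => simp
  | ha x x' hx hx' =>
    rw [add_mul, add_mul, map_add]
    exact J.add_mem hx hx'
  | hs h s =>
    obtain ⟨b, hb⟩ := exists_mk_one_mul_inclusion f P h a
    have e : mk f h s = s • mk f h 1 := by rw [smul_mk, smul_eq_mul, mul_one]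
    rw [e, smul_mul, hb, smul_mul, proj_smul, mul_assoc, proj_inclusion_mul, ← smul_mul]
    refine J.mul_mem_right _ ?_
    rw [← one_mul b, ← smul_mul]
    exact J.mul_mem_left _ ((hJ h a b hb).mp ha)

/-- The two-sided ideal `(A^f * G) J` for a two-sided ideal `J` of `A^f * P` stable under
conjugation by the `U_g`. -/
noncomputable def extendIdeal [P.Normal] (J : Ideal (CrossedProduct (f.restrict P)))
    [J.IsTwoSided]
    (hJ : ∀ (g : G) (x y : CrossedProduct (f.restrict P)),
      mk f g 1 * inclusion f P x = inclusion f P y * mk f g 1 → (x ∈ J ↔ y ∈ J)) :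
    Ideal (CrossedProduct f) where
  carrier := {x | ∀ g, proj f P g x ∈ J}
  add_mem' hx hy g := by
    rw [map_add]
    exact J.add_mem (hx g) (hy g)
  zero_mem' g := by
    rw [map_zero]
    exact J.zero_mem
  smul_mem' x y hy g := by
    have := Fintype.ofFinite (Quotient (QuotientGroup.rightRel P))
    rw [sum_inclusion_proj_mul_mk_one f P y, finsum_eq_sum_of_fintype, smul_eq_mul,
      Finset.mul_sum, map_sum]
    refine J.sum_mem fun c _ => ?_
    rw [← mul_assoc]
    exact proj_mul_inclusion_mul_mem f J hJ _ _ (hy _) g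

section ExtendIdeal

variable [P.Normal] {J : Ideal (CrossedProduct (f.restrict P))} [J.IsTwoSided]
    (hJ : ∀ (g : G) (x y : CrossedProduct (f.restrict P)),
      mk f g 1 * inclusion f P x = inclusion f P y * mk f g 1 → (x ∈ J ↔ y ∈ J))

theorem mem_extendIdeal {x : CrossedProduct f} :
    x ∈ extendIdeal f J hJ ↔ ∀ g, proj f P g x ∈ J := Iff.rfl

theorem mul_inclusion_mul_mem_extendIdeal (x y : CrossedProduct f)
    {a : CrossedProduct (f.restrict P)} (ha : a ∈ J) :
    x * inclusion f P a * y ∈ extendIdeal f J hJ :=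
  proj_mul_inclusion_mul_mem f J hJ x y ha

theorem inclusion_mul_mem_extendIdeal (y : CrossedProduct f)
    {a : CrossedProduct (f.restrict P)} (ha : a ∈ J) :
    inclusion f P a * y ∈ extendIdeal f J hJ := by
  rw [← one_mul (inclusion f P a)]
  exact mul_inclusion_mul_mem_extendIdeal f hJ 1 y ha

theorem extendIdeal_induction {p : CrossedProduct f → Prop} (h0 : p 0)
    (hadd : ∀ x y, p x → p y → p (x + y))
    (h : ∀ (g : G), ∀ a ∈ J, p (inclusion f P a * mk f g 1))
    {x : CrossedProduct f} (hx : x ∈ extendIdeal f J hJ) : p x := by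
  have := Fintype.ofFinite (Quotient (QuotientGroup.rightRel P))
  rw [sum_inclusion_proj_mul_mk_one f P x, finsum_eq_sum_of_fintype]
  exact Finset.sum_induction _ p hadd h0 fun c _ => h _ _ (hx _)

theorem mul_mem_right_extendIdeal {x : CrossedProduct f} (hx : x ∈ extendIdeal f J hJ)
    (y : CrossedProduct f) : x * y ∈ extendIdeal f J hJ := by
  refine extendIdeal_induction f hJ (p := fun x => x * y ∈ extendIdeal f J hJ) ?_
    (fun x x' h h' => ?_) (fun g a ha => ?_) hx
  · simp
  · rw [add_mul]
    exact add_mem h h'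
  · rw [mul_assoc]
    exact inclusion_mul_mem_extendIdeal f hJ _ ha

/-- Thus I ⊆ I² would descend to J ⊆ J², which Nakayama excludes. -/
theorem proj_mul_mem_smul {x y : CrossedProduct f} (hx : x ∈ extendIdeal f J hJ)
    (hy : y ∈ extendIdeal f J hJ) (g : G) : proj f P g (x * y) ∈ J • J := by
  refine extendIdeal_induction f hJ (p := fun x => proj f P g (x * y) ∈ J • J) ?_
    (fun x x' h h' => ?_) (fun k a ha => ?_) hx
  · simp
  · rw [add_mul, map_add]
    exact add_mem h h'
  · rw [mul_assoc, proj_inclusion_mul]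
    exact Submodule.smul_mem_smul ha (Ideal.mul_mem_left _ _ hy g)

end ExtendIdeal

end Subgroup

end CrossedProduct

/-! ### Linear forms on J from either hypothesis on T. -/

namespace CrossedProduct

section LinearForm

variable {G A : Type*} [Group G] [Finite G] [CommRing A] [MulSemiringAction G A]
  (f : TwoCocycle G A) {P : Subgroup G} [P.Normal]
  {J : Ideal (CrossedProduct (f.restrict P))} [J.IsTwoSided]

theorem exists_linearMap_of_projective
    (hJ : ∀ (g : G) (x y : CrossedProduct (f.restrict P)),
      mk f g 1 * inclusion f P x = inclusion f P y * mk f g 1 → (x ∈ J ↔ y ∈ J))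
    [Module.Projective (CrossedProduct f) (extendIdeal f J hJ)]
    (hne : ¬ J ≤ J • J) :
    ∃ (φ : J →ₗ[CrossedProduct (f.restrict P)] CrossedProduct (f.restrict P)) (y : J),
      φ y ∉ J := by
  let I := extendIdeal f J hJ
  -- A section of the free cover is a dual basis: x = ∑ s(x)_i i. If all the coordinates s(x)_i lay
  -- in I, then I ⊆ I².
  obtain ⟨s, hs⟩ := Module.Projective.out (R := CrossedProduct f) (P := I)
  obtain ⟨i, y, hy⟩ : ∃ i y : I, s y i ∉ I := by
    by_contra! hall
    refine hne fun j hj => ?_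
    have h1 : inclusion f P j * mk f 1 1 ∈ I := inclusion_mul_mem_extendIdeal f hJ _ hj
    have h2 := congrArg Subtype.val (hs ⟨_, h1⟩)
    have h3 := proj_inclusion_mul_mk_one f P 1 j
    dsimp only at h2
    rw [← h3, ← h2, Finsupp.linearCombination_apply, Finsupp.sum, AddSubmonoidClass.coe_finsetSum,
      map_sum]
    exact sum_mem fun i _ => proj_mul_mem_smul f hJ (hall i _) i.2 1
  obtain ⟨g, a, ha, hga⟩ : ∃ g, ∃ a, ∃ ha : a ∈ J,
      s ⟨inclusion f P a * mk f g 1, inclusion_mul_mem_extendIdeal f hJ _ ha⟩ i ∉ I := by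
    by_contra! hall
    refine hy ?_
    have h : ∃ hy' : (y : CrossedProduct f) ∈ I, s ⟨y, hy'⟩ i ∈ I := by
      refine extendIdeal_induction f hJ (p := fun x => ∃ hx : x ∈ I, s ⟨x, hx⟩ i ∈ I) ?_ ?_ ?_ y.2
      · refine ⟨I.zero_mem, ?_⟩
        have : (⟨0, I.zero_mem⟩ : I) = 0 := rfl
        rw [this, map_zero]
        exact I.zero_mem
      · rintro x x' ⟨hx, h⟩ ⟨hx', h'⟩
        refine ⟨I.add_mem hx hx', ?_⟩
        have : (⟨x + x', I.add_mem hx hx'⟩ : I) = ⟨x, hx⟩ + ⟨x', hx'⟩ := rfl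
        rw [this, map_add, Finsupp.add_apply]
        exact I.add_mem h h'
      · exact fun g a ha => ⟨inclusion_mul_mem_extendIdeal f hJ _ ha, hall g a ha⟩
    exact h.2
  -- The bad value is now located on one summand J U_g and in one coset coordinate k; the desired
  -- form is the restriction of the coordinate functional to these.
  obtain ⟨k, hk⟩ := not_forall.mp ((mem_extendIdeal f hJ).not.mp hga)
  let e (b : J) : I := ⟨inclusion f P b * mk f g 1, inclusion_mul_mem_extendIdeal f hJ _ b.2⟩
  have he (b : J) : (e b : CrossedProduct f) = inclusion f P b * mk f g 1 := rfl
  have hadd (b b' : J) : e (b + b') = e b + e b' := by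
    apply Subtype.ext
    rw [Submodule.coe_add, he, he, he, Submodule.coe_add, map_add, add_mul]
  have hsmul (r : CrossedProduct (f.restrict P)) (b : J) : e (r • b) = inclusion f P r • e b := by
    apply Subtype.ext
    rw [Submodule.coe_smul, he, he, Submodule.coe_smul, smul_eq_mul, smul_eq_mul, map_mul,
      mul_assoc]
  refine ⟨
    { toFun b := proj f P k (s (e b) i)
      map_add' b b' := ?_
      map_smul' r b := ?_ }, ⟨a, ha⟩, hk⟩
  · rw [hadd, map_add, Finsupp.add_apply, map_add]
  · rw [hsmul, map_smul, Finsupp.smul_apply, smul_eq_mul, proj_inclusion_mul, RingHom.id_apply,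
      smul_eq_mul]

theorem exists_linearMap_of_isMaximalOrderIn [IsDomain A]
    [IsNoetherianRing (FixedPoints.subring A G)]
    {L : Type*} [Field L] [Algebra A L] [FaithfulSMul A L] [MulSemiringAction G L]
    [SMulDistribClass G A L]
    (hJ : ∀ (g : G) (x y : CrossedProduct (f.restrict P)),
      mk f g 1 * inclusion f P x = inclusion f P y * mk f g 1 → (x ∈ J ↔ y ∈ J))
    (hmax : IsMaximalOrderIn (FixedPoints.subring A G)
      (toBaseChange f (FixedPoints.subring A G) L).range)
    {a : A} (ha : ∀ g : G, g • a = a) (ha0 : a ≠ 0) (haJ : a • 1 ∈ J)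
    {t : CrossedProduct (f.restrict P)} (ht : ¬ ∃ w, t = a • w)
    (hJt : ∀ j ∈ J, ∃ w, j * t = a • w) :
    ∃ (φ : J →ₗ[CrossedProduct (f.restrict P)] CrossedProduct (f.restrict P)) (y : J),
      φ y ∉ J := by
  let R := FixedPoints.subring A G
  let I := extendIdeal f J hJ
  let τ := toBaseChange f R L
  let a₀ : R := ⟨a, ha⟩
  have hcancel {w w' : CrossedProduct (f.restrict P)} (h : a • w = a • w') : w = w' :=
    ext_coeff fun g => mul_left_cancel₀ ha0 (congrArg (fun x => coeff x g) h)
  choose! w hw using hJt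
  -- Here w j = jt/a. Either this form leaves J and is the one sought, or J(t/a) ⊆ J, which
  -- contradicts maximality.
  by_cases hwJ : ∃ y : J, w y ∉ J
  · obtain ⟨y, hy⟩ := hwJ
    refine ⟨
      { toFun j := w j
        map_add' j j' := hcancel ?_
        map_smul' r j := hcancel ?_ }, y, hy⟩
    · rw [smul_add, ← hw _ j.2, ← hw _ j'.2, ← hw _ (j + j').2, Submodule.coe_add, add_mul]
    · rw [RingHom.id_apply, smul_eq_mul, ← mul_smul_of_invariant (fun g : P => ha g) r, ← hw _ j.2,
        ← hw _ (r • j).2, Submodule.coe_smul, smul_eq_mul, mul_assoc]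
  push Not at hwJ
  exfalso
  have hsmul (x : CrossedProduct f) : a₀ • x = a • x := rfl
  have ha₀ : algebraMap R L a₀ ≠ 0 := by
    rw [IsScalarTower.algebraMap_apply R A L]
    exact (map_ne_zero_iff _ (FaithfulSMul.algebraMap_injective A L)).mpr ha0
  have hLsmul (r : R) (x : CrossedProduct (f.baseChange L)) : r • x = algebraMap R L r • x := by
    refine ext_coeff fun g => ?_
    exact Algebra.smul_def r (coeff x g)
  -- the order of all `c` with `I c ⊆ I`
  let Γ : Subalgebra R (CrossedProduct (f.baseChange L)) :=
    { carrier := {c | ∀ x ∈ I, ∃ y ∈ I, τ x * c = τ y}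
      mul_mem' := by
        intro c c' hc hc' x hx
        obtain ⟨y, hy, e⟩ := hc x hx
        obtain ⟨y', hy', e'⟩ := hc' y hy
        exact ⟨y', hy', by rw [← mul_assoc, e, e']⟩
      add_mem' := by
        intro c c' hc hc' x hx
        obtain ⟨y, hy, e⟩ := hc x hx
        obtain ⟨y', hy', e'⟩ := hc' x hx
        exact ⟨y + y', I.add_mem hy hy', by rw [mul_add, e, e', map_add]⟩
      algebraMap_mem' := by
        intro r x hx
        refine ⟨x * algebraMap R _ r, mul_mem_right_extendIdeal f hJ hx _, ?_⟩
        rw [map_mul, AlgHom.commutes] }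
  have hle : τ.range ≤ Γ := by
    rintro _ ⟨z, rfl⟩ x hx
    exact ⟨x * z, mul_mem_right_extendIdeal f hJ hx _, (map_mul τ x z).symm⟩
  have haI : a • (1 : CrossedProduct f) ∈ I := by
    have h := inclusion_mul_mem_extendIdeal f hJ 1 haJ
    rwa [inclusion_smul, map_one, mul_one] at h
  -- As a·1 lies in I, multiplication by `a` embeds Γ in the finitely generated module T; so Γ is an
  -- order.
  have hΓa (c : Γ) : a₀ • (c : CrossedProduct (f.baseChange L)) ∈ τ.range := by
    obtain ⟨y, -, e⟩ := c.2 _ haI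
    refine ⟨y, e.symm.trans ?_⟩
    rw [← hsmul, map_smul, map_one, smul_mul_assoc, one_mul]
  have hΓ : IsOrderIn R Γ := by
    refine ⟨?_, fun x => ?_⟩
    · have hfin : Module.Finite R τ.range.toSubmodule := Module.Finite.iff_fg.mpr hmax.1.1
      let m : Γ.toSubmodule →ₗ[R] τ.range.toSubmodule :=
        { toFun c := ⟨a₀ • (c : CrossedProduct (f.baseChange L)), hΓa c⟩
          map_add' c c' := Subtype.ext (smul_add _ _ _)
          map_smul' r c := Subtype.ext (smul_comm a₀ r (c : CrossedProduct (f.baseChange L))) }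
      have hm : Function.Injective m := by
        intro c c' h
        have h1 : a₀ • (c : CrossedProduct (f.baseChange L)) = a₀ • (c' : CrossedProduct _) :=
          congrArg Subtype.val h
        rw [hLsmul, hLsmul] at h1
        refine Subtype.ext (ext_coeff fun g => mul_left_cancel₀ ha₀ ?_)
        exact congrArg (fun x => coeff x g) h1
      have : IsNoetherian R τ.range.toSubmodule := isNoetherian_of_isNoetherianRing_of_finite R _
      exact Module.Finite.iff_fg.mp (Module.Finite.of_injective m hm)
    · obtain ⟨r, hr, hx⟩ := hmax.1.2 x
      exact ⟨r, hr, hle hx⟩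
  -- t/a stabilizes I on the right: write b U_g = U_g b' with b' in J and use J(t/a) ⊆ J. By
  -- maximality t/a then lies in T, hence t is a multiple of `a`.
  have hc : (algebraMap R L a₀)⁻¹ • τ (inclusion f P t) ∈ Γ := by
    intro x hx
    have hx' : ∃ y ∈ I, x * inclusion f P t = a • y := by
      refine extendIdeal_induction f hJ (p := fun x => ∃ y ∈ I, x * inclusion f P t = a • y)
        ⟨0, I.zero_mem, by simp⟩ ?_ (fun g b hb => ?_) hx
      · rintro x x' ⟨y, hy, e⟩ ⟨y', hy', e'⟩
        exact ⟨y + y', I.add_mem hy hy', by rw [add_mul, e, e', smul_add]⟩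
      · obtain ⟨b', hb'⟩ := exists_inclusion_mul_mk_one f P g b
        have hb'J : b' ∈ J := (hJ g b' b hb').mpr hb
        refine ⟨mk f g 1 * inclusion f P (w b') * 1,
          mul_inclusion_mul_mem_extendIdeal f hJ _ _ (hwJ ⟨b', hb'J⟩), ?_⟩
        rw [← hb', mul_assoc, ← map_mul, hw _ hb'J, inclusion_smul, mul_smul_of_invariant ha,
          mul_one]
    obtain ⟨y, hy, e⟩ := hx'
    refine ⟨y, hy, ?_⟩
    have h1 : τ x * τ (inclusion f P t) = algebraMap R L a₀ • τ y := by
      rw [← map_mul, e, ← hsmul, map_smul, hLsmul]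
    have h2 : ∀ g : G, g • (algebraMap R L a₀)⁻¹ = (algebraMap R L a₀)⁻¹ := by
      intro g
      rw [smul_inv'', smul_algebraMap]
    rw [mul_smul_of_invariant h2, h1, inv_smul_smul₀ ha₀]
  obtain ⟨z, hz⟩ := hmax.2 hΓ hle hc
  refine ht ⟨proj f P 1 (z * mk f 1 1), ?_⟩
  have h1 : τ (a • z) = τ (inclusion f P t) := by
    rw [← hsmul, map_smul, hLsmul]
    have hz' : τ z = (algebraMap R L a₀)⁻¹ • τ (inclusion f P t) := hz
    rw [hz', smul_inv_smul₀ ha₀]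
  have hτ : Function.Injective τ :=
    Finsupp.mapRange_injective _ (map_zero _) (FaithfulSMul.algebraMap_injective A L)
  rw [← proj_smul, ← smul_mul, hτ h1, proj_inclusion_mul_mk_one]

end LinearForm

end CrossedProduct

/-! ### Centrality of P in the inertia group, and the main theorem. -/

namespace CrossedProduct

theorem exists_mk_one_pow {G A : Type*} [Group G] [CommRing A] [MulSemiringAction G A]
    {f : TwoCocycle G A} (g : G) (n : ℕ) : ∃ s : A, mk f g 1 ^ n = mk f (g ^ n) s := by
  induction n with
  | zero => exact ⟨_, by rw [pow_zero, pow_zero, one_def']⟩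
  | succ n ih =>
    obtain ⟨s, hs⟩ := ih
    exact ⟨_, by rw [pow_succ, hs, mk_mul_mk, pow_succ]⟩

theorem exists_mk_one_pow_card {G A : Type*} [Group G] [CommRing A] [MulSemiringAction G A]
    {f : TwoCocycle G A} (g : G) : ∃ s : A, mk f g 1 ^ Nat.card G = s • 1 := by
  obtain ⟨s, hs⟩ := exists_mk_one_pow (f := f) g (Nat.card G)
  refine ⟨s * f.toFun 1 1, ?_⟩
  rw [hs, pow_card_eq_one', smul_one_eq, Units.mul_inv_cancel_right]

/-- If the nonunits of `S^f * P` are the multiples of a uniformizer of `S`, then `P` is centralized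
by the inertia group. -/
theorem mul_eq_mul_of_nonunitsIdeal {G S : Type*} [CommRing S] [IsDomain S]
    [IsDiscreteValuationRing S] [Group G] [MulSemiringAction G S]
    {p : ℕ} [Fact p.Prime] [CharP (ResidueField S) p] (f : TwoCocycle G S)
    {P : Subgroup G} [P.Normal] [Fintype P] [DecidableEq P] (hP : IsPGroup p P)
    (htriv : ∀ (h : P) (s : S), h • s - s ∈ maximalIdeal S) {π : S} (hπ : Irreducible π)
    (hJ : ∀ z ∈ nonunitsIdeal (f.restrict P) hP htriv, ∃ w, z = π • w)
    {c g : G} (hc : c ∈ ramificationGroup G S 1) (hg : g ∈ P) : c * g = g * c := by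
  let u : CrossedProduct (f.restrict P) := mk _ ⟨g, hg⟩ 1
  let g' : P := ⟨c * g * c⁻¹, ‹P.Normal›.conj_mem g hg c⟩
  let y : CrossedProduct (f.restrict P) :=
    mk _ g' (f.toFun c g * ((f.toFun (c * g * c⁻¹) c)⁻¹ : Sˣ))
  have hy : mk f c 1 * inclusion f P u = inclusion f P y * mk f c 1 := by
    rw [inclusion_mk, inclusion_mk, mk_mul_mk, mk_mul_mk, inv_mul_cancel_right, smul_one, mul_one,
      smul_one, mul_one, Units.inv_mul_cancel_right, one_mul]
  have hpow (n : ℕ) : mk f c 1 * inclusion f P (u ^ n) = inclusion f P (y ^ n) * mk f c 1 := by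
    induction n with
    | zero => rw [pow_zero, pow_zero, map_one (inclusion f P), mul_one, one_mul]
    | succ n ih =>
      rw [pow_succ, pow_succ, map_mul, map_mul, ← mul_assoc, ih, mul_assoc, hy, mul_assoc]
  obtain ⟨s, hs⟩ := exists_mk_one_pow_card (f := f.restrict P) (⟨g, hg⟩ : P)
  have hys : y ^ Nat.card P = (c • s) • 1 := by
    have h := hpow (Nat.card P)
    rw [hs, inclusion_smul, map_one (inclusion f P), mk_mul_smul, mul_one,
      ← one_mul (mk f c 1), ← smul_mul, one_mul] at h
    refine inclusion_injective f P ((isUnit_mk_one c).mul_right_cancel ?_)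
    rw [← h, inclusion_smul, map_one (inclusion f P)]
  obtain ⟨n, hn⟩ := IsPGroup.iff_card.mp hP
  -- The |P|-th powers of `u` and of its conjugate `y` are the scalars s and c(s), which agree in
  -- the residue field; p-power maps are injective there.
  have hres : residueNorm _ hP htriv (y - u) = 0 := by
    have h1 : residueNorm _ hP htriv (y ^ Nat.card P) = residueNorm _ hP htriv (u ^ Nat.card P) := by
      have h2 : residue S (c • s) = residue S s :=
        Ideal.Quotient.eq.mpr (mem_ramificationGroup_one.mp hc s)
      rw [hys, hs, residueNorm_smul_one, residueNorm_smul_one, h2]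
    rw [map_pow, map_pow, hn, ← sub_eq_zero, ← sub_pow_char_pow, ← map_sub] at h1
    exact pow_eq_zero_iff (pow_ne_zero n (Fact.out : p.Prime).ne_zero) |>.mp h1
  obtain ⟨w, hw⟩ := hJ _ hres
  by_contra hne
  have hg' : g' ≠ ⟨g, hg⟩ := fun h =>
    hne (mul_inv_eq_iff_eq_mul.mp (congrArg Subtype.val h))
  -- At g the conjugate contributes 0 and `u` contributes 1, so π would divide -1.
  have h1 := congrArg (fun x => coeff x (⟨g, hg⟩ : P)) hw
  simp only [map_sub, Finsupp.sub_apply, coeff_smul_apply] at h1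
  rw [coeff_mk_apply, coeff_mk_apply, if_neg hg', if_pos rfl, zero_sub] at h1
  exact hπ.not_isUnit (IsUnit.of_mul_eq_one (-coeff w (⟨g, hg⟩ : P)) (by linear_combination h1))

end CrossedProduct

open CrossedProduct in
/-- If `S^f * G` is hereditary or a maximal order, the second ramification group is centralized by
the inertia group. -/
theorem mul_eq_mul_of_hereditary_or_maximal {S L G : Type*} [CommRing S] [IsDomain S]
    [IsDiscreteValuationRing S] [Field L] [Algebra S L] [IsFractionRing S L]
    [Group G] [Finite G] [MulSemiringAction G S] [FaithfulSMul G S]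
    [MulSemiringAction G L] [SMulDistribClass G S L]
    (hsep : IsResiduallySeparable G S) (f : TwoCocycle G S)
    (hT : IsHereditaryRing (CrossedProduct f) ∨
      IsMaximalOrderIn (FixedPoints.subring S G)
        (CrossedProduct.toBaseChange f (FixedPoints.subring S G) L).range)
    (p : ℕ) [ExpChar (ResidueField S) p]
    {c g : G} (hc : c ∈ ramificationGroup G S 1) (hg : g ∈ ramificationGroup G S 2) :
    c * g = g * c := by
  classical
  let P := ramificationGroup G S 2
  have hPp : IsPGroup p P := isPGroup_ramificationGroup_two p
  rcases ‹ExpChar (ResidueField S) p› with _ | hp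
  · have := isPGroup_one_iff_subsingleton.mp hPp
    have h1 : (⟨g, hg⟩ : P) = 1 := Subsingleton.elim _ _
    have h2 : g = 1 := congrArg Subtype.val h1
    rw [h2, mul_one, one_mul]
  have : Fact p.Prime := ⟨hp⟩
  have := Fintype.ofFinite P
  have := Fintype.ofFinite G
  have : P.Normal := ramificationGroup_normal 2
  have hle : P ≤ ramificationGroup G S 1 := ramificationGroup_antitone one_le_two
  have htriv (h : P) (s : S) : h • s - s ∈ maximalIdeal S :=
    mem_ramificationGroup_one.mp (hle h.2) s
  have hres (s : S) : ∃ r : S, (∀ h : P, h • r = r) ∧ s - r ∈ maximalIdeal S := by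
    obtain ⟨r, hr, hs⟩ := exists_fixed_sub_mem_of_isResiduallySeparable hsep s
    exact ⟨r, fun h => hr h (hle h.2), hs⟩
  obtain ⟨π, hπ⟩ := IsDiscreteValuationRing.exists_irreducible S
  let J := nonunitsIdeal (f.restrict P) hPp htriv
  have hJ (g : G) (x y : CrossedProduct (f.restrict P))
      (h : mk f g 1 * inclusion f P x = inclusion f P y * mk f g 1) : x ∈ J ↔ y ∈ J := by
    rw [mem_nonunitsIdeal, mem_nonunitsIdeal, isUnit_iff_of_mk_one_mul_inclusion h]
  obtain ⟨φ, y, hy⟩ : ∃ (φ : J →ₗ[CrossedProduct (f.restrict P)] CrossedProduct (f.restrict P))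
      (y : J), φ y ∉ J := by
    rcases hT with hher | hmax
    · have := hher.1 (extendIdeal f J hJ)
      exact exists_linearMap_of_projective f hJ (not_nonunitsIdeal_le_smul_self hPp htriv)
    -- The product runs over all of `G`, not only P: `a` must be central in T.
    · let a : S := ∏ h : G, h • π
      have ha (g : G) : g • a = a := Finset.smul_prod_perm π g
      have ha0 : a ≠ 0 := Finset.prod_ne_zero_iff.mpr fun h _ h0 =>
        hπ.ne_zero ((smul_eq_zero_iff_eq h).mp h0)
      have haM : a ∈ maximalIdeal S := by
        rw [mem_maximalIdeal_iff_dvd hπ]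
        refine dvd_trans ?_ (Finset.dvd_prod_of_mem (fun h : G => h • π) (Finset.mem_univ 1))
        rw [one_smul]
      obtain ⟨t, ht, hJt⟩ := exists_mul_mem_smul_of_not_mem (f := f.restrict P) hPp htriv
        (fun h : P => ha h) ha0 haM
      exact exists_linearMap_of_isMaximalOrderIn f hJ hmax ha ha0
        (smul_one_mem_nonunitsIdeal hPp htriv haM) ht hJt
  exact mul_eq_mul_of_nonunitsIdeal f hPp htriv hπ
    (fun z hz => exists_eq_smul_of_linearMap hPp htriv hres hπ φ y hy hz) hc hg

/-- The exponential characteristic treats both cases at once: in residue characteristic 0 it is 1, a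
1-group is trivial, and being prime to 1 is no condition. -/
theorem theoremA {S L G : Type*} [CommRing S] [IsDomain S] [IsDiscreteValuationRing S]
    [Field L] [Algebra S L] [IsFractionRing S L]
    [Group G] [Finite G] [MulSemiringAction G S] [FaithfulSMul G S]
    [MulSemiringAction G L] [SMulDistribClass G S L]
    (hsep : IsResiduallySeparable G S)
    (f : TwoCocycle G S)
    (hT : IsHereditaryRing (CrossedProduct f) ∨
      IsMaximalOrderIn (FixedPoints.subring S G)
        (CrossedProduct.toBaseChange f (FixedPoints.subring S G) L).range)
    (p : ℕ) [ExpChar (IsLocalRing.ResidueField S) p] :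
    (∀ σ ∈ ramificationGroup G S 1, ∀ τ ∈ ramificationGroup G S 1, σ * τ = τ * σ) ∧
    ramificationGroup G S 2 ≤ ramificationGroup G S 1 ∧
    (∃ Q : Sylow p (ramificationGroup G S 1),
      (Q : Subgroup (ramificationGroup G S 1)) =
        (ramificationGroup G S 2).subgroupOf (ramificationGroup G S 1)) ∧
    ∃ C : Subgroup G, IsCyclic C ∧ (Nat.card C).Coprime p ∧
      ∃ φ : ramificationGroup G S 2 × C ≃* ramificationGroup G S 1,
        ∀ (a : ramificationGroup G S 2) (c : C), (φ (a, c) : G) = a * c := by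
  let I := ramificationGroup G S 1
  let P := ramificationGroup G S 2
  have hle : P ≤ I := ramificationGroup_antitone one_le_two
  have hPp : IsPGroup p P := isPGroup_ramificationGroup_two p
  have hPn : P.Normal := ramificationGroup_normal 2
  have hNp : IsPGroup p (P.subgroupOf I) := hPp.of_equiv (Subgroup.subgroupOfEquivOfLe hle).symm
  obtain ⟨θ, hθ⟩ := exists_tame_character (G := G) (S := S)
    (exists_fixed_sub_mem_of_isResiduallySeparable hsep)
  have hfin : Finite θ.range := .of_surjective θ.rangeRestrict θ.rangeRestrict_surjective
  have hcyc : IsCyclic θ.range := isCyclic_subgroup_units θ.range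
  -- The absence of p-power torsion in the residue field's units makes P a maximal p-subgroup and
  -- the order of the image of θ prime to p.
  have htor {x : (ResidueField S)ˣ} {k : ℕ} (hx : x ^ p ^ k = 1) : x = 1 := by
    have h := congrArg Units.val hx
    rw [Units.val_pow_eq_pow_val, Units.val_one, ← sub_eq_zero] at h
    have h2 : ((x : ResidueField S) - 1) ^ p ^ k = 0 := by
      rw [sub_pow_expChar_pow, one_pow, h]
    exact Units.ext (sub_eq_zero.mp (pow_eq_zero_iff
      (pow_ne_zero k (expChar_pos (ResidueField S) p).ne') |>.mp h2))
  have hcomm : ∀ σ τ : I, σ * τ = τ * σ := by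
    refine (MonoidHom.isMulCommutative_of_isCyclic_of_ker_le_center θ.rangeRestrict ?_).is_comm.comm
    rw [MonoidHom.ker_rangeRestrict, hθ]
    intro σ hσ
    rw [Subgroup.mem_center_iff]
    exact fun c => Subtype.ext
      (mul_eq_mul_of_hereditary_or_maximal (L := L) hsep f hT p c.2 hσ)
  refine ⟨fun σ hσ τ hτ => congrArg Subtype.val (hcomm ⟨σ, hσ⟩ ⟨τ, hτ⟩), hle,
    ⟨⟨P.subgroupOf I, hNp, fun {Q} hQ hNQ => le_antisymm (fun x hx => ?_) hNQ⟩, rfl⟩, ?_⟩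
  · obtain ⟨k, hk⟩ := isPGroup_iff_pow_pow_eq_one.mp hQ ⟨x, hx⟩
    have hk' : x ^ p ^ k = 1 := congrArg Subtype.val hk
    rw [← hθ, MonoidHom.mem_ker]
    exact htor (k := k) (by rw [← map_pow, hk', map_one])
  have hidx : (P.subgroupOf I).index = Nat.card θ.range := by rw [← hθ, Subgroup.index_ker]
  have hcop : (Nat.card θ.range).Coprime p := by
    rcases expChar_is_prime_or_one (ResidueField S) p with hp | rfl
    · have : Fact p.Prime := ⟨hp⟩
      refine ((Nat.Prime.coprime_iff_not_dvd hp).mpr fun hdvd => ?_).symm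
      obtain ⟨x, hx⟩ := exists_prime_orderOf_dvd_card' p hdvd
      have h1 : x = 1 := Subtype.ext (htor (k := 1) (by
        rw [pow_one, ← hx, ← SubgroupClass.coe_pow, pow_orderOf_eq_one, Subgroup.coe_one]))
      rw [h1, orderOf_one] at hx
      exact hp.ne_one hx.symm
    · exact Nat.coprime_one_right _
  have hNcop : (Nat.card (P.subgroupOf I)).Coprime (P.subgroupOf I).index := by
    obtain ⟨n, hn⟩ := isPGroup_iff_card_dvd_pow.mp hNp
    rw [hidx]
    exact Nat.Coprime.coprime_dvd_left hn (hcop.symm.pow_left n)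
  -- Schur–Zassenhaus; θ is injective on the complement, which is therefore cyclic.
  obtain ⟨C, hC⟩ := Subgroup.exists_right_complement'_of_coprime hNcop
  have hinj : Function.Injective (θ.comp C.subtype) := by
    refine (injective_iff_map_eq_one _).mpr fun c hc => ?_
    have h1 : (c : I) ∈ P.subgroupOf I := by
      rw [← hθ]
      exact hc
    have h2 : (c : I) ∈ (P.subgroupOf I) ⊓ C := ⟨h1, c.2⟩
    rw [hC.disjoint.eq_bot, Subgroup.mem_bot] at h2
    exact Subtype.ext h2
  have hCcyc : IsCyclic C := isCyclic_of_injective_ringHom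
    ((Units.coeHom (ResidueField S)).comp (θ.comp C.subtype)) (Units.val_injective.comp hinj)
  have hCcard : Nat.card C = Nat.card θ.range := by rw [← hidx, hC.symm.index_eq_card]
  let ε : C ≃* C.map I.subtype := C.equivMapOfInjective _ I.subtype_injective
  have hε (c : C) : (ε c : G) = c := rfl
  refine ⟨C.map I.subtype, ?_, ?_, ?_⟩
  · exact isCyclic_of_surjective ε ε.surjective
  · rwa [← Nat.card_congr ε.toEquiv, hCcard]
  · let ψ : P × C.map I.subtype →* I :=
      { toFun x := Subgroup.inclusion hle x.1 * (ε.symm x.2 : C)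
        map_one' := by simp
        map_mul' x y := by
          simp only [Prod.fst_mul, Prod.snd_mul, map_mul, Subgroup.coe_mul]
          rw [mul_assoc, mul_assoc, ← mul_assoc (Subgroup.inclusion hle y.1),
            hcomm (Subgroup.inclusion hle y.1), mul_assoc] }
    have hψ : Function.Bijective ψ := by
      let η : P × C.map I.subtype ≃ P.subgroupOf I × C :=
        (Subgroup.subgroupOfEquivOfLe hle).symm.toEquiv.prodCongr ε.symm.toEquiv
      exact (show Function.Bijective fun x : P.subgroupOf I × C => (x.1 : I) * x.2 from hC).comp
        η.bijective
    refine ⟨MulEquiv.ofBijective ψ hψ, fun a c => ?_⟩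
    change (a : G) * ((ε.symm c : C) : G) = a * c
    rw [← hε, MulEquiv.apply_symm_apply]
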